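/- Let $g\ge 0$ and let $K_a=\mathbb{C}(q,\alpha_1,\dots,\alpha_g)$ be the field of rational functions in $g+1$ independent variables, and put $\bar\alpha_i=q/\alpha_i$ (for $g\ge1$ this is the function field of the torus $T_a=\{(\eta_1,\bar\eta_1,\dots,\eta_g,\bar\eta_g)\in(\mathbb{C}^\times)^{2g} : \eta_i\bar\eta_i=\eta_j\bar\eta_j\ \forall i,j\}\simeq(\mathbb{C}^\times)^{g+1}$, in the coordinates $\alpha_i=\eta_i$, $q=\eta_i\bar\eta_i$). Put $$g_X(z)=z^{g-1}\,\frac{1-qz}{1-z^{-1}}\prod_{i=1}^g(1-\alpha_iz^{-1})(1-\bar\alpha_iz^{-1}).$$ For $r\ge 1$ let the rank-$r$ part $\mathbf{A}_{K_a,r}\subset K_a(x_1,\dots,x_r)$ of the universal shuffle algebra be the image of $$\Psi_r:K_a[x_1^{\pm1},\dots,x_r^{\pm1}]\to K_a(x_1,\dots,x_r)^{\mathfrak{S}_r},\qquad P\mapsto\sum_{w\in\mathfrak{S}_r}w\Big(\prod_{i<j}g_X(x_i/x_j)\;P(x_1,\dots,x_r)\Big).$$ Let $Z_r\subset S^r(K_a^*)=(K_a^*)^r/\mathfrak{S}_r$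 be the set of all orbits of points $(x_1,\dots,x_r)$ with $x_1=\alpha x_2$ and $x_2=\bar\alpha x_3$ for some $\alpha\in\{\alpha_1,\bar\alpha_1,\dots,\alpha_g,\bar\alpha_g\}$ (where $\bar{\bar\alpha}_i=\alpha_i$; $Z_r=\emptyset$ if $r<3$), let $I_r\subset K_a[x_1^{\pm1},\dots,x_r^{\pm1}]^{\mathfrak{S}_r}$ be the (radical) ideal of all symmetric Laurent polynomials that vanish on $Z_r$, and let $\Delta(x)=\prod_{i<j}(x_i-x_j)$. Then, for every $r\ge1$, $\mathbf{A}_{K_a,r}$ is an ideal of $K_a[x_1^{\pm1},\dots,x_r^{\pm1}]^{\mathfrak{S}_r}$, and $$\Delta(x)^{2\lfloor r!/4\rfloor}\,I_r\subseteq\mathbf{A}_{K_a,r}\subseteq I_r .$$ The exponent is $r!/2$ for $r\ge4$, and it is $0,0,2$ for $r=1,2,3$. Moreover, if $r>2$ and $g>0$, then $\mathbf{A}_{K_a,r}$ is not a free $K_a[x_1^{\pm1},\dots,x_r^{\pm1}]^{\mathfrak{S}_r}$-module. -/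

import Mathlib

noncomputable section

namespace WheelShuffle

/-! ### The ground field and the Weil numbers -/

/-- The field `K_a` of rational functions on the torus
`T_a = {(η₁, η̄₁, …, η_g, η̄_g) : η_i η̄_i = η_j η̄_j} ≃ (ℂˣ)^(g+1)`, in the coordinates
`q = η_i η̄_i` (index `none`) and `α_i = η_i` (index `some i`); thus `η̄_i = q / α_i`. -/
abbrev Ka (g : ℕ) : Type := FractionRing (MvPolynomial (Option (Fin g)) ℂ)

/-- The coordinate `q`. -/
def q (g : ℕ) : Ka g := algebraMap (MvPolynomial (Option (Fin g)) ℂ) (Ka g) (MvPolynomial.X none)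

/-- The universal Weil number `α_i`. -/
def alpha (g : ℕ) (i : Fin g) : Ka g :=
  algebraMap (MvPolynomial (Option (Fin g)) ℂ) (Ka g) (MvPolynomial.X (some i))

/-- The family `α_1, …, α_g, ᾱ_1, …, ᾱ_g`, where `α_i * ᾱ_i = q`. -/
def weil (g : ℕ) : Fin g ⊕ Fin g → Ka g :=
  Sum.elim (fun i => alpha g i) (fun i => q g / alpha g i)

/-! ### Laurent polynomials -/

/-- The ring `K[x_1^{±1}, …, x_r^{±1}]`. -/
abbrev Laurent (K : Type) [Field K] (r : ℕ) : Type := AddMonoidAlgebra K (Fin r → ℤ)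

/-- The variable `x_i`, as a unit of the ring of Laurent polynomials. -/
def Laurent.x (K : Type) [Field K] (r : ℕ) (i : Fin r) : (Laurent K r)ˣ :=
  Units.map (AddMonoidAlgebra.of K (Fin r → ℤ)) (toUnits (Multiplicative.ofAdd (Pi.single i 1)))

/-- Substitution `x_i ↦ z_i` of units of a `K`-algebra in Laurent polynomials. -/
def Laurent.eval {K : Type} [Field K] {r : ℕ} {A : Type} [CommRing A] [Algebra K A]
    (z : Fin r → Aˣ) : Laurent K r →ₐ[K] A :=
  AddMonoidAlgebra.lift K A (Fin r → ℤ)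
    { toFun := fun n => ((∏ i, z i ^ (Multiplicative.toAdd n i) : Aˣ) : A)
      map_one' := by simp
      map_mul' := fun m n => by
        simp [zpow_add, Finset.prod_mul_distrib] }

/-- The ring `K[x_1^{±1}, …, x_r^{±1}]^{𝔖_r}` of symmetric Laurent polynomials. -/
def SymLaurent (K : Type) [Field K] (r : ℕ) : Subalgebra K (Laurent K r) :=
  ⨅ σ : Equiv.Perm (Fin r),
    AlgHom.equalizer (Laurent.eval fun i => Laurent.x K r (σ i)) (AlgHom.id K (Laurent K r))

/-- An ideal as a module over the ring: Mathlib's instance, named here to shorten the search. -/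
instance idealModule (K : Type) [Field K] (r : ℕ) (A : Ideal (SymLaurent K r)) : Module (SymLaurent K r) A :=
  Submodule.module A

/-- `Δ(x) = ∏_{i<j} (x_i - x_j)`. -/
def vandermonde (K : Type) [Field K] (r : ℕ) : Laurent K r :=
  ∏ i : Fin r, ∏ j ∈ Finset.Ioi i, ((Laurent.x K r i : Laurent K r) - (Laurent.x K r j : Laurent K r))

/-! ### Rational functions and the shuffle algebra -/

/-- The field `K(x_1, …, x_r)`. -/
abbrev RatFun (K : Type) [Field K] (r : ℕ) : Type := FractionRing (MvPolynomial (Fin r) K)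

/-- The variable `x_i`, as a nonzero rational function. -/
def RatFun.x (K : Type) [Field K] (r : ℕ) (i : Fin r) : (RatFun K r)ˣ :=
  Units.mk0 (algebraMap (MvPolynomial (Fin r) K) (RatFun K r) (MvPolynomial.X i)) (by simp)

/-- The inclusion of Laurent polynomials in rational functions. -/
def toRat (K : Type) [Field K] (r : ℕ) : Laurent K r →ₐ[K] RatFun K r :=
  Laurent.eval (RatFun.x K r)

/-- The permutation `x_i ↦ x_{σ i}` of the variables of a rational function. -/
def RatFun.perm (K : Type) [Field K] (r : ℕ) (σ : Equiv.Perm (Fin r)) : RatFun K r ≃ₐ[K] RatFun K r :=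
  IsFractionRing.algEquivOfAlgEquiv (MvPolynomial.renameEquiv K σ)

/-- `g_X(z) = z^{g-1} (1 - q z) / (1 - z⁻¹) ∏_i (1 - α_i z⁻¹) (1 - ᾱ_i z⁻¹)`, evaluated at an
element `z` of an extension field of `K_a`. -/
def gX (g : ℕ) {F : Type} [Field F] [Algebra (Ka g) F] (z : F) : F :=
  z ^ ((g : ℤ) - 1) * ((1 - algebraMap (Ka g) F (q g) * z) / (1 - z⁻¹)) *
    ∏ w : Fin g ⊕ Fin g, (1 - algebraMap (Ka g) F (weil g w) * z⁻¹)

/-- The weight `g_X(x_1, …, x_r) = ∏_{i<j} g_X(x_i / x_j)`. -/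
def weight (g r : ℕ) : RatFun (Ka g) r :=
  ∏ i : Fin r, ∏ j ∈ Finset.Ioi i,
    gX g ((RatFun.x (Ka g) r i : RatFun (Ka g) r) / (RatFun.x (Ka g) r j : RatFun (Ka g) r))

/-- The weighted symmetrization
`Ψ_r(P) = ∑_{w ∈ 𝔖_r} w (g_X(x_1, …, x_r) P(x_1, …, x_r))`. -/
def Psi (g r : ℕ) : Laurent (Ka g) r →ₗ[Ka g] RatFun (Ka g) r :=
  ∑ w : Equiv.Perm (Fin r), (RatFun.perm (Ka g) r w).toLinearMap ∘ₗ
    LinearMap.mulLeft (Ka g) (weight g r) ∘ₗ (toRat (Ka g) r).toLinearMap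

/-- The rank `r` component `A_{K_a, r}` of the universal shuffle algebra: the image of `Ψ_r`. -/
def shuffleA (g r : ℕ) : Submodule (Ka g) (RatFun (Ka g) r) := LinearMap.range (Psi g r)

/-! ### The wheel locus -/

/-- The points of `(K_aˣ)^r` above the wheel locus `Z_r ⊆ S^r(K_aˣ)`: up to a permutation of the
coordinates, `x_1 = α x_2` and `x_2 = ᾱ x_3` for some `α` among `α_1, ᾱ_1, …, α_g, ᾱ_g`. -/
def wheelLocus (g r : ℕ) : Set (Fin r → (Ka g)ˣ) :=
  {z | ∃ (w : Fin g ⊕ Fin g) (i j k : Fin r), i ≠ j ∧ j ≠ k ∧ i ≠ k ∧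
    (z i : Ka g) = weil g w * z j ∧ (z j : Ka g) = weil g w.swap * z k}

/-- The ideal `I_r` of all symmetric Laurent polynomials that vanish on `Z_r`. -/
def wheelIdeal (g r : ℕ) : Ideal (SymLaurent (Ka g) r) :=
  ⨅ z ∈ wheelLocus g r, RingHom.ker ((Laurent.eval z).comp (SymLaurent (Ka g) r).val)

end WheelShuffle

end

noncomputable section

/-! ### Laurent polynomials: evaluation, substitution, independence of monomials -/

namespace WheelShuffle
variable {K : Type} [Field K] {r : ℕ}

/-! Clearing denominators. The weight times Δ is a Laurent polynomial `N`, a unit times `numer r 1`,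
and Δ · Ψ(P) = `alt (N * P)`. Alternating Laurent polynomials are divisible by Δ, so the shuffle
component is the ideal `symIdeal N` of symmetric Laurent polynomials (`shuffleA_eq`).

Upper bound. On a wheel the factors of the pairs (i, j), (j, k), (k, i) all vanish, and every
ordering of the variables respects an arc of this directed triangle. Hence every permuted numerator
vanishes there, while Δ is not identically zero on the wheel component and can be cancelled.

Lower bound. An interpolation identity puts `N` into the ideal generated by `symIdeal N` in the full
Laurent ring (`mem_extIdeal`), and averaging leads back to symmetric elements
(`mem_symIdeal_of_mem_extIdeal`). It therefore suffices that Δ^e f lies in the ideal of all permuted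
numerators, which is tested at each maximal ideal 𝔪. There, in rescaled variables y = x/c, each
factor is a multiplier outside 𝔪, times y_a - y_b if (a, b) is an arc of a graph: an arc `Up`
multiplies c by q, an arc `Dn` divides it by a Weil number. A height with α of height 1 and q of
height 2 keeps the two kinds apart. Up to a multiplier outside 𝔪, the numerators generate everything
in `arcIdeal`.

If the points of the configuration are distinct, every f that vanishes on the triangles lies in
`arcIdeal`, without any Δ (`mem_arcIdeal_aux`, an induction that removes the highest vertex). If
points coincide, each arc costs at most one factor Δ, and there are at most r(r-1)/2 - 1 arcs
(`WeilData.vandermonde_pow_mul_mem`).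

Non-freeness. A nonzero free ideal of a domain is principal. A generator would divide all permuted
numerators, which have no common prime factor, so it would be a unit; yet it vanishes on the wheels.
-/

theorem Laurent.x_coe (i : Fin r) :
    (Laurent.x K r i : Laurent K r) = AddMonoidAlgebra.single (Pi.single i 1) 1 := rfl

theorem Laurent.prod_x_zpow (n : Fin r → ℤ) :
    ((∏ i, Laurent.x K r i ^ n i : (Laurent K r)ˣ) : Laurent K r) =
      AddMonoidAlgebra.single n 1 := by
  have h : ∀ i, Laurent.x K r i ^ n i = Units.map (AddMonoidAlgebra.of K (Fin r → ℤ))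
      (toUnits (Multiplicative.ofAdd (Pi.single i (n i)))) := by
    intro i
    rw [Laurent.x, ← map_zpow, ← map_zpow, ← ofAdd_zsmul]
    congr 3
    ext j
    simp [Pi.single_apply]
  simp_rw [h]
  rw [← map_prod, ← map_prod, ← ofAdd_sum, Finset.univ_sum_single]
  rfl

@[simp]
theorem Laurent.eval_x {A : Type} [CommRing A] [Algebra K A] (z : Fin r → Aˣ) (i : Fin r) :
    Laurent.eval (K := K) z (Laurent.x K r i : Laurent K r) = z i := by
  rw [Laurent.x_coe, Laurent.eval, AddMonoidAlgebra.lift_single]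
  have : ∀ x, z x ^ (Pi.single i 1 : Fin r → ℤ) x = if x = i then z x else 1 := fun x => by
    by_cases hx : x = i <;> simp [hx]
  simp only [MonoidHom.coe_mk, OneHom.coe_mk, toAdd_ofAdd, this, Finset.prod_ite_eq',
    Finset.mem_univ, if_true, one_smul]

theorem Laurent.algHom_ext {A : Type} [CommRing A] [Algebra K A] {φ ψ : Laurent K r →ₐ[K] A}
    (h : ∀ i, φ (Laurent.x K r i : Laurent K r) = ψ (Laurent.x K r i : Laurent K r)) : φ = ψ := by
  apply AddMonoidAlgebra.algHom_ext
  · intro n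
    rw [← Laurent.prod_x_zpow]
    have h' : ∀ i, Units.map (φ : Laurent K r →* A) (Laurent.x K r i) =
        Units.map (ψ : Laurent K r →* A) (Laurent.x K r i) := fun i => Units.ext (h i)
    have := congrArg (Units.val) (show
      Units.map (φ : Laurent K r →* A) (∏ i, Laurent.x K r i ^ n i) =
        Units.map (ψ : Laurent K r →* A) (∏ i, Laurent.x K r i ^ n i) by
      simp only [map_prod, map_zpow, h'])
    exact this
  · exact Subsingleton.elim _ _

theorem Laurent.smul_x_sub_ne_zero {a b : Fin r} {u v : K} (hu : u ≠ 0) (h : a = b → u ≠ v) :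
    u • (Laurent.x K r a : Laurent K r) - v • (Laurent.x K r b : Laurent K r) ≠ 0 := by
  rw [sub_ne_zero, Laurent.x_coe, Laurent.x_coe]
  intro e
  have e1 := congrArg (fun f : Laurent K r => f.coeff (Pi.single a 1)) e
  by_cases hab : a = b
  · subst hab
    exact h rfl (by simpa using e1)
  · have : (Pi.single b 1 : Fin r → ℤ) ≠ Pi.single a 1 := fun e => by
      simpa [Pi.single_apply, hab] using congrFun e a
    simp [this] at e1
    exact hu e1

/-- The substitution `x_a ↦ u_a x_{τ a}`. -/
def Laurent.subst (u : Fin r → Kˣ) (τ : Fin r → Fin r) : Laurent K r →ₐ[K] Laurent K r :=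
  Laurent.eval fun a => Units.map (algebraMap K (Laurent K r) : K →* Laurent K r) (u a) * Laurent.x K r (τ a)

@[simp]
theorem Laurent.subst_x (u : Fin r → Kˣ) (τ : Fin r → Fin r) (a : Fin r) :
    Laurent.subst u τ (Laurent.x K r a : Laurent K r) =
      (u a : K) • (Laurent.x K r (τ a) : Laurent K r) := by
  rw [Laurent.subst, Laurent.eval_x, Algebra.smul_def]; rfl

theorem Laurent.sub_apply_mem (φ : Laurent K r →ₐ[K] Laurent K r) (I : Ideal (Laurent K r))
    (h : ∀ i, (Laurent.x K r i : Laurent K r) - φ (Laurent.x K r i) ∈ I) (f : Laurent K r) :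
    f - φ f ∈ I := by
  rw [← Ideal.Quotient.eq]
  have : (Ideal.Quotient.mkₐ K I) = (Ideal.Quotient.mkₐ K I).comp φ :=
    Laurent.algHom_ext fun i => (Ideal.Quotient.eq).2 (h i)
  exact DFunLike.congr_fun this f

/-- Monomials are characters of the torus, and distinct characters are linearly independent. They
are told apart at the points with one coordinate 2, which has infinite order in characteristic zero.
-/
theorem Laurent.eq_zero_of_eval [CharZero K] (f : Laurent K r)
    (h : ∀ z : Fin r → Kˣ, Laurent.eval z f = 0) : f = 0 := by
  let χ : (Fin r → ℤ) → ((Fin r → Kˣ) →* K) := fun n =>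
    { toFun := fun z => ((∏ i, z i ^ n i : Kˣ) : K)
      map_one' := by simp
      map_mul' := fun a b => by simp [mul_zpow, Finset.prod_mul_distrib] }
  have hχ : Function.Injective χ := by
    intro n n' e
    funext i
    have := DFunLike.congr_fun e (Pi.mulSingle i (Units.mk0 (2 : K) two_ne_zero))
    simp only [χ, MonoidHom.coe_mk, OneHom.coe_mk, Units.val_inj] at this
    rw [Finset.prod_eq_single i, Finset.prod_eq_single i] at this
    · simp only [Pi.mulSingle_eq_same, ← Units.val_inj, Units.val_zpow_eq_zpow_val,
        Units.val_mk0] at this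
      have h2 : ((2 : ℚ) : K) ^ n i = ((2 : ℚ) : K) ^ n' i := by simpa using this
      rw [← Rat.cast_zpow, ← Rat.cast_zpow, Rat.cast_inj] at h2
      exact zpow_right_injective₀ (by norm_num) (by norm_num) h2
    all_goals simp +contextual
  have hl := (linearIndependent_monoidHom (Fin r → Kˣ) K).comp χ hχ
  rw [linearIndependent_iff] at hl
  have : f.coeff = 0 := by
    apply hl
    funext z
    rw [Pi.zero_apply, ← h z, Laurent.eval, AddMonoidAlgebra.lift_apply, Finsupp.linearCombination_apply,
      Finsupp.sum, Finsupp.sum, Finset.sum_apply]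
    rfl
  exact AddMonoidAlgebra.coeff_injective this
end WheelShuffle

/-! ### Rescaled variables and the ideal of a wheel graph -/

namespace WheelShuffle
variable {K : Type} [Field K] {r : ℕ}

/-- The variable `x_a` rescaled by the unit `c_a⁻¹`. -/
def Laurent.y (c : Fin r → Kˣ) (a : Fin r) : Laurent K r :=
  ((c a : K)⁻¹) • (Laurent.x K r a : Laurent K r)

/-- The substitution `y_a ↦ y_{τ a}` of the rescaled variables. -/
def Laurent.substY (c : Fin r → Kˣ) (τ : Fin r → Fin r) : Laurent K r →ₐ[K] Laurent K r :=
  Laurent.subst (fun a => c a / c (τ a)) τ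

@[simp]
theorem Laurent.substY_y (c : Fin r → Kˣ) (τ : Fin r → Fin r) (a : Fin r) :
    Laurent.substY c τ (Laurent.y c a) = Laurent.y c (τ a) := by
  rw [Laurent.y, map_smul, Laurent.substY, Laurent.subst_x, smul_smul, Laurent.y]
  congr 1
  simp only [Units.val_div_eq_div_val]
  field_simp

theorem Laurent.x_eq_smul_y (c : Fin r → Kˣ) (a : Fin r) :
    (Laurent.x K r a : Laurent K r) = (c a : K) • Laurent.y c a := by
  rw [Laurent.y, smul_smul, mul_inv_cancel₀ (c a).ne_zero, one_smul]

theorem Laurent.algHom_ext_y {A : Type} [CommRing A] [Algebra K A] (c : Fin r → Kˣ)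
    {φ ψ : Laurent K r →ₐ[K] A} (h : ∀ a, φ (Laurent.y c a) = ψ (Laurent.y c a)) : φ = ψ :=
  Laurent.algHom_ext fun i => by rw [Laurent.x_eq_smul_y c, map_smul, map_smul, h]

theorem Laurent.substY_substY (c : Fin r → Kˣ) (τ ρ : Fin r → Fin r) (f : Laurent K r) :
    Laurent.substY c τ (Laurent.substY c ρ f) = Laurent.substY c (τ ∘ ρ) f := by
  have : (Laurent.substY c τ).comp (Laurent.substY c ρ) = Laurent.substY c (τ ∘ ρ) :=
    Laurent.algHom_ext_y c fun a => by simp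
  exact DFunLike.congr_fun this f

theorem Laurent.y_sub_ne_zero (c : Fin r → Kˣ) {a b : Fin r} (h : a ≠ b) :
    Laurent.y c a - Laurent.y c b ≠ 0 :=
  Laurent.smul_x_sub_ne_zero (inv_ne_zero (c a).ne_zero) fun e => absurd e h

/-- The substitution `y_a ↦ y_b`, which fixes the other variables, is the reduction modulo
`y_a - y_b`. -/
theorem Laurent.sub_dvd_sub_substY (c : Fin r → Kˣ) (a b : Fin r) (f : Laurent K r) :
    Laurent.y c a - Laurent.y c b ∣
      f - Laurent.substY c (Function.update id a b) f := by
  rw [← Ideal.mem_span_singleton]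
  refine Laurent.sub_apply_mem _ _ (fun i => ?_) f
  rw [Laurent.x_eq_smul_y c, map_smul, ← smul_sub, Laurent.substY_y]
  refine Submodule.smul_of_tower_mem _ _ ?_
  by_cases h : i = a
  · subst h
    simp
  · simp [h]

theorem Laurent.sub_dvd_of_substY (c : Fin r → Kˣ) {a b : Fin r} {f : Laurent K r}
    (h : Laurent.substY c (Function.update id a b) f = 0) :
    Laurent.y c a - Laurent.y c b ∣ f := by
  simpa [h] using Laurent.sub_dvd_sub_substY c a b f

/-- A product of distinct irreducible differences divides `f` if each of them does. -/
theorem Laurent.prod_sub_dvd (c : Fin r → Kˣ) (B : Finset (Fin r × Fin r)) {f : Laurent K r}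
    (hB : ∀ p ∈ B, Laurent.substY c (Function.update id p.1 p.2) f = 0)
    (hne : ∀ p ∈ B, ∀ p' ∈ B, p ≠ p' → (Function.update id p.1 p.2 : Fin r → Fin r) p'.1 ≠
      (Function.update id p.1 p.2 : Fin r → Fin r) p'.2) :
    ∏ p ∈ B, (Laurent.y c p.1 - Laurent.y c p.2) ∣ f := by
  classical
  induction B using Finset.induction_on with
  | empty => simp
  | insert p B hp ih =>
    obtain ⟨h, rfl⟩ := ih (fun p' hp' => hB p' (Finset.mem_insert_of_mem hp'))
      (fun p' hp' p'' hp'' => hne p' (Finset.mem_insert_of_mem hp') p''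
        (Finset.mem_insert_of_mem hp''))
    have h0 := hB p (Finset.mem_insert_self _ _)
    -- The substitution for `p` kills `f` but none of the differences already split off, so it kills
    -- the remaining cofactor.
    rw [map_mul, map_prod, mul_eq_zero, Finset.prod_eq_zero_iff] at h0
    rw [Finset.prod_insert hp, mul_comm]
    refine mul_dvd_mul_left _ (Laurent.sub_dvd_of_substY c (h0.resolve_left ?_))
    rintro ⟨p', hp', h0⟩
    rw [map_sub, Laurent.substY_y, Laurent.substY_y] at h0
    exact Laurent.y_sub_ne_zero c (hne p (Finset.mem_insert_self _ _) p'
      (Finset.mem_insert_of_mem hp') (fun e => hp (e ▸ hp'))) h0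

open Classical in
/-- The product of the differences `y_a - y_b` over the edges `a → b` that increase `ω`. -/
def arcProd (c : Fin r → Kˣ) (G : Fin r → Fin r → Prop) (ω : Fin r → ℤ) : Laurent K r :=
  ∏ p : Fin r × Fin r, if G p.1 p.2 ∧ ω p.1 < ω p.2 then Laurent.y c p.1 - Laurent.y c p.2 else 1

/-- The ideal spanned by the products `arcProd` over all total orders of the vertices. -/
def arcIdeal (c : Fin r → Kˣ) (G : Fin r → Fin r → Prop) : Ideal (Laurent K r) :=
  Ideal.span (arcProd c G '' {ω | Function.Injective ω})

theorem arcProd_mem (c : Fin r → Kˣ) (G : Fin r → Fin r → Prop) {ω : Fin r → ℤ}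
    (h : Function.Injective ω) : arcProd c G ω ∈ arcIdeal c G :=
  Ideal.subset_span ⟨ω, h, rfl⟩

theorem arcIdeal_mul_mem {c : Fin r → Kˣ} {G : Fin r → Fin r → Prop} {I : Ideal (Laurent K r)}
    {e : Laurent K r} (h : ∀ ω : Fin r → ℤ, Function.Injective ω → e * arcProd c G ω ∈ I)
    {f : Laurent K r} (hf : f ∈ arcIdeal c G) : e * f ∈ I := by
  have : arcIdeal c G ≤ Submodule.comap (LinearMap.mulLeft (Laurent K r) e) I := by
    rw [arcIdeal, Ideal.span_le]
    rintro _ ⟨ω, hω, rfl⟩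
    exact h ω hω
  exact this hf

theorem exists_last (S : Fin r → ℤ) (hS : Function.Injective S) (m : Fin r) :
    ∃ ω : Fin r → ℤ, Function.Injective ω ∧ (∀ a b, a ≠ m → b ≠ m → (ω a < ω b ↔ S a < S b)) ∧
      ∀ a, ¬ ω m < ω a := by
  have hb : ∀ a, S a ≤ ∑ i, |S i| := fun a =>
    (le_abs_self _).trans (Finset.single_le_sum (f := fun i => |S i|) (fun _ _ => abs_nonneg _)
      (Finset.mem_univ a))
  refine ⟨fun a => if a = m then ∑ i, |S i| + 1 else S a, fun a b h => ?_, fun a b ha hb => ?_,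
    fun a => ?_⟩
  · have h1 := hb a
    have h2 := hb b
    by_cases ha : a = m <;> by_cases hb : b = m <;> simp only [ha, hb, if_true, if_false] at h ⊢
    · subst ha; omega
    · subst hb; omega
    · exact hS h
  · simp [ha, hb]
  · have h1 := hb a
    by_cases ha : a = m <;> simp only [ha, if_true, if_false] <;> omega

theorem exists_just_before (S : Fin r → ℤ) (hS : Function.Injective S) (m c : Fin r) :
    ∃ ω : Fin r → ℤ, Function.Injective ω ∧ (∀ a b, a ≠ m → b ≠ m → (ω a < ω b ↔ S a < S b)) ∧
      (∀ a, a ≠ m → (ω m < ω a ↔ S c ≤ S a)) ∧ (∀ a, a ≠ m → (ω a < ω m ↔ S a < S c)) := by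
  -- Doubling leaves odd values free; the one just below `c` goes to `m`.
  refine ⟨fun a => if a = m then 2 * S c - 1 else 2 * S a, fun a b h => ?_, fun a b ha hb => ?_,
    fun a ha => ?_, fun a ha => ?_⟩
  · by_cases ha : a = m <;> by_cases hb : b = m <;> simp only [ha, hb, if_true, if_false] at h ⊢
    · omega
    · omega
    · exact hS (by omega)
  · simp [ha, hb]
  · simp only [ha, if_true, if_false]; omega
  · simp only [ha, if_true, if_false]; omega

/-- The combinatorics of a configuration of points with distinct values: `Up` and `Dn` are the
arcs that raise and lower the height, and every path `a → m → b` of an `Up` and a `Dn` arc closes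
up to a directed triangle. -/
structure IsWheelGraph (ht : Fin r → ℤ) (Up Dn : Fin r → Fin r → Prop) : Prop where
  up_lt : ∀ {a b}, Up a b → ht a < ht b
  dn_lt : ∀ {a b}, Dn a b → ht b < ht a
  up_source : ∀ {a b m}, Up a m → Up b m → a = b
  up_target : ∀ {a m n}, Up a m → Up a n → m = n
  close : ∀ {a m b}, Up a m → Dn m b → Dn b a
  not_both : ∀ {a m}, Up a m → ¬ Dn m a

/-- The map that collapses `m` and `b` to `a`. -/
def collapse (m b a : Fin r) : Fin r → Fin r := fun i => if i = m ∨ i = b then a else i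

theorem prod_ite_col (m : Fin r) (F : Fin r → Laurent K r) :
    ∏ p : Fin r × Fin r, (if p.2 = m then F p.1 else 1) = ∏ b, F b := by
  rw [Fintype.prod_prod_type]
  simp

theorem prod_ite_row (m : Fin r) (F : Fin r → Laurent K r) :
    ∏ p : Fin r × Fin r, (if p.1 = m then F p.2 else 1) = ∏ b, F b := by
  rw [Fintype.prod_prod_type, Finset.prod_comm]
  simp

theorem prod_sub_mod (c : Fin r → Kˣ) (m a : Fin r) (P : Fin r → Prop) [DecidablePred P] :
    Laurent.y c m - Laurent.y c a ∣
      (∏ b, if P b then Laurent.y c b - Laurent.y c a else 1) -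
        ∏ b, if P b then Laurent.y c b - Laurent.y c m else 1 := by
  rw [← Ideal.mem_span_singleton, ← Ideal.Quotient.eq, map_prod, map_prod]
  refine Finset.prod_congr rfl fun b _ => ?_
  split_ifs
  · rw [Ideal.Quotient.eq, Ideal.mem_span_singleton]
    exact ⟨1, by ring⟩
  · rfl

/-- Induction on the number of vertices, removing a highest vertex m. If a → m is an `Up` arc, split
f into its value at y_m = y_a and a multiple of y_m - y_a. The value is divisible by y_b - y_a for
all arcs m → b, because a, m, b form a triangle. Both cofactors are handled by the graph without m,
and orders of the remaining vertices are extended by a suitable place for m. -/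
theorem mem_arcIdeal_aux (c : Fin r → Kˣ) (ht : Fin r → ℤ) (n : ℕ) :
    ∀ (V : Finset (Fin r)) (Up Dn : Fin r → Fin r → Prop), V.card = n →
      (∀ a b, Up a b ∨ Dn a b → a ∈ V ∧ b ∈ V) → IsWheelGraph ht Up Dn →
      ∀ f : Laurent K r,
        (∀ m b a, Up a m → Dn m b → Laurent.substY c (collapse m b a) f = 0) →
        f ∈ arcIdeal c (fun a b => Up a b ∨ Dn a b) := by
  classical
  induction n with
  | zero =>
    intro V Up Dn hn hV _ f _
    obtain rfl := Finset.card_eq_zero.1 hn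
    have h1 : arcProd c (fun a b => Up a b ∨ Dn a b) (fun i => ((i : ℕ) : ℤ)) = 1 :=
      Finset.prod_eq_one fun p _ => if_neg fun h => by simpa using hV _ _ h.1
    have := arcProd_mem c (fun a b => Up a b ∨ Dn a b) (ω := fun i => ((i : ℕ) : ℤ))
      (fun a b h => Fin.ext (by simpa using h))
    rw [h1] at this
    simpa using Ideal.mul_mem_left _ f this
  | succ n ih =>
    intro V Up Dn hn hV hG f hf
    -- At a highest vertex only `Up` arcs enter, at most one by `up_source`, and only `Dn` arcs
    -- leave.
    obtain ⟨m, hmV, hm⟩ := V.exists_max_image ht (Finset.card_pos.1 (by omega))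
    have hup : ∀ b, ¬ Up m b := fun b h =>
      absurd (hG.up_lt h) (not_lt.2 (hm b (hV _ _ (Or.inl h)).2))
    have hdn : ∀ b, ¬ Dn b m := fun b h =>
      absurd (hG.dn_lt h) (not_lt.2 (hm b (hV _ _ (Or.inr h)).1))
    set J := arcIdeal c (fun a b => Up a b ∨ Dn a b) with hJ
    set Up' : Fin r → Fin r → Prop := fun x y => Up x y ∧ x ≠ m ∧ y ≠ m with hUp'
    set Dn' : Fin r → Fin r → Prop := fun x y => Dn x y ∧ x ≠ m ∧ y ≠ m with hDn'
    have hcard : (V.erase m).card = n := by rw [Finset.card_erase_of_mem hmV]; omega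
    have ih' := ih (V.erase m) Up' Dn' hcard (by
      rintro a b (⟨h, ha, hb⟩ | ⟨h, ha, hb⟩)
      · exact ⟨Finset.mem_erase.2 ⟨ha, (hV _ _ (Or.inl h)).1⟩,
          Finset.mem_erase.2 ⟨hb, (hV _ _ (Or.inl h)).2⟩⟩
      · exact ⟨Finset.mem_erase.2 ⟨ha, (hV _ _ (Or.inr h)).1⟩,
          Finset.mem_erase.2 ⟨hb, (hV _ _ (Or.inr h)).2⟩⟩)
      ⟨fun h => hG.up_lt h.1, fun h => hG.dn_lt h.1, fun h h' => hG.up_source h.1 h'.1,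
        fun h h' => hG.up_target h.1 h'.1, fun h h' => ⟨hG.close h.1 h'.1, h'.2.2, h.2.1⟩,
        fun h h' => hG.not_both h.1 h'.1⟩
    by_cases hc : ∃ a, Up a m
    · obtain ⟨a, ha⟩ := hc
      have ham : a ≠ m := fun e => hup m (e ▸ ha)
      have hba : ∀ b, Dn m b → b ≠ a := fun b hb e => hG.not_both ha (e ▸ hb)
      have hbm : ∀ b, Dn m b → b ≠ m := fun b hb e => hdn m (e ▸ hb)
      -- reduction modulo `y_m - y_a`
      obtain ⟨h', hh'⟩ := Laurent.sub_dvd_sub_substY c m a f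
      set σf := Laurent.substY c (Function.update id m a) f with hσf
      have hφσ : ∀ m₁ b₁ a₁, Up' a₁ m₁ → Dn' m₁ b₁ →
          Laurent.substY c (collapse m₁ b₁ a₁) f = 0 ∧
          Laurent.substY c (collapse m₁ b₁ a₁) σf = 0 := by
        intro m₁ b₁ a₁ h1 h2
        have h0 := hf _ _ _ h1.1 h2.1
        refine ⟨h0, ?_⟩
        have : collapse m₁ b₁ a₁ ∘ (Function.update id m a : Fin r → Fin r) =
            (Function.update id m (collapse m₁ b₁ a₁ a) : Fin r → Fin r) ∘
              collapse m₁ b₁ a₁ := by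
          have hmm : collapse m₁ b₁ a₁ m = m := by
            simp [collapse, h1.2.2.symm, h2.2.2.symm]
          funext i
          by_cases hi : i = m
          · subst hi; simp [hmm]
          · have : collapse m₁ b₁ a₁ i ≠ m := by
              unfold collapse; split_ifs
              · exact h1.2.1
              · exact hi
            simp [hi, this]
        rw [hσf, Laurent.substY_substY, this, ← Laurent.substY_substY, h0, map_zero]
      have hh'mem : h' ∈ arcIdeal c (fun x y => Up' x y ∨ Dn' x y) := by
        refine ih' h' fun m₁ b₁ a₁ h1 h2 => ?_
        have h3 := congrArg (Laurent.substY c (collapse m₁ b₁ a₁)) hh'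
        obtain ⟨h4, h5⟩ := hφσ _ _ _ h1 h2
        rw [map_sub, h4, h5, sub_zero, map_mul, map_sub, Laurent.substY_y, Laurent.substY_y,
          eq_comm, mul_eq_zero] at h3
        refine h3.resolve_left (Laurent.y_sub_ne_zero c ?_)
        have hmm : collapse m₁ b₁ a₁ m = m := by
          simp [collapse, h1.2.2.symm, h2.2.2.symm]
        rw [hmm]
        unfold collapse; split_ifs
        · exact h1.2.1.symm
        · exact ham.symm
      -- the smaller graph without the arcs `b → a`
      set Dn'' : Fin r → Fin r → Prop := fun x y => Dn' x y ∧ ¬ (y = a ∧ Dn m x) with hDn''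
      have ih'' := ih (V.erase m) Up' Dn'' hcard (by
        rintro x y (⟨h, hx, hy⟩ | ⟨⟨h, hx, hy⟩, -⟩)
        · exact ⟨Finset.mem_erase.2 ⟨hx, (hV _ _ (Or.inl h)).1⟩,
            Finset.mem_erase.2 ⟨hy, (hV _ _ (Or.inl h)).2⟩⟩
        · exact ⟨Finset.mem_erase.2 ⟨hx, (hV _ _ (Or.inr h)).1⟩,
            Finset.mem_erase.2 ⟨hy, (hV _ _ (Or.inr h)).2⟩⟩)
        ⟨fun h => hG.up_lt h.1, fun h => hG.dn_lt h.1.1, fun h h' => hG.up_source h.1 h'.1,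
          fun h h' => hG.up_target h.1 h'.1,
          fun h h' => ⟨⟨hG.close h.1 h'.1.1, h'.1.2.2, h.2.1⟩,
            fun e => h.2.2 (hG.up_target h.1 (e.1 ▸ ha))⟩,
          fun h h' => hG.not_both h.1 h'.1.1⟩
      obtain ⟨h, hh⟩ : (∏ b, if Dn m b then Laurent.y c b - Laurent.y c a else 1) ∣ σf := by
        have := Laurent.prod_sub_dvd c ((Finset.univ.filter (Dn m)) ×ˢ {a}) (f := σf) (by
          rintro ⟨b, a'⟩ hp
          obtain ⟨hb, rfl⟩ : Dn m b ∧ a = a' := by simpa using hp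
          rw [hσf, Laurent.substY_substY, ← hf m b a ha hb]
          congr 2
          funext i
          by_cases hi : i = m
          · subst hi; simp [collapse, (hba b hb).symm]
          · by_cases hi' : i = b
            · subst hi'; simp [collapse, hi]
            · simp [collapse, hi, hi']) (by
          rintro ⟨b, a'⟩ hp ⟨b', a''⟩ hp' hne
          obtain ⟨hb, rfl⟩ : Dn m b ∧ a = a' := by simpa using hp
          obtain ⟨hb', rfl⟩ : Dn m b' ∧ a = a'' := by simpa using hp'
          have hbb : b' ≠ b := fun e => hne (by rw [e])
          simp [hbb, (hba b hb).symm, hba b' hb'])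
        simpa [Finset.prod_product, Finset.prod_filter] using this
      have hhmem : h ∈ arcIdeal c (fun x y => Up' x y ∨ Dn'' x y) := by
        refine ih'' h fun m₁ b₁ a₁ h1 h2 => ?_
        have h3 := congrArg (Laurent.substY c (collapse m₁ b₁ a₁)) hh
        rw [(hφσ _ _ _ h1 h2.1).2, map_mul, map_prod, eq_comm, mul_eq_zero,
          Finset.prod_eq_zero_iff] at h3
        refine h3.resolve_left ?_
        rintro ⟨b, -, hb0⟩
        split_ifs at hb0 with hb
        · rw [map_sub, Laurent.substY_y, Laurent.substY_y] at hb0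
          refine Laurent.y_sub_ne_zero c ?_ hb0
          -- It remains to see that the collapse does not identify `a` and `b`. Heights rule out all
          -- coincidences but `b = m₁`, `a = b₁`, and that would need an arc `b → a` which `Dn''`
          -- omits.
          have e1 := hG.close ha hb
          have e2 := hba b hb
          have l1 := hG.up_lt h1.1
          have l2 := hG.dn_lt h2.1.1
          have l3 := hG.dn_lt e1
          have e3 := hG.close h1.1 h2.1.1
          have l4 := hG.dn_lt e3
          have n2 := h2.2
          have n3 : ¬ (a₁ = a ∧ Dn m b₁) := fun e => h1.2.2 (hG.up_target h1.1 (e.1 ▸ ha))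
          have n4 := hG.not_both h1.1
          have n5 : a₁ ≠ a := fun e => h1.2.2 (hG.up_target h1.1 (e ▸ ha))
          unfold collapse
          by_cases p1 : b = m₁ ∨ b = b₁ <;> by_cases p2 : a = m₁ ∨ a = b₁ <;>
            simp only [p1, p2, if_true, if_false]
          · rcases p1 with rfl | rfl <;> rcases p2 with rfl | rfl
            · exact absurd rfl e2
            · exact absurd ⟨rfl, hb⟩ n2
            · omega
            · exact absurd rfl e2
          · exact n5
          · rintro rfl
            rcases p2 with rfl | rfl
            · omega
            · omega
          · exact e2
        · simp at hb0
      have hfE : f = (∏ b, if Dn m b then Laurent.y c b - Laurent.y c a else 1) * h +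
          (Laurent.y c m - Laurent.y c a) * h' := by rw [← hh, ← hh']; ring
      -- With `m` in the last place, `a → m` is the only arc at `m` that increases the order.
      have ht' : ∀ ω : Fin r → ℤ, Function.Injective ω → (Laurent.y c m - Laurent.y c a) *
          arcProd c (fun x y => Up' x y ∨ Dn' x y) ω ∈ J := by
        intro ω hω
        obtain ⟨ω', hω', h1, h2⟩ := exists_last ω hω m
        refine Ideal.mem_of_dvd _ ?_ (arcProd_mem c _ hω')
        rw [← Finset.prod_ite_eq' Finset.univ (a, m)
          (fun _ => Laurent.y c m - Laurent.y c a) |>.trans (if_pos (Finset.mem_univ _)),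
          arcProd, arcProd, ← Finset.prod_mul_distrib]
        refine Finset.prod_dvd_prod_of_dvd _ _ fun p _ => ?_
        obtain ⟨x, y⟩ := p
        by_cases hp : (Up x y ∨ Dn x y) ∧ ω' x < ω' y
        swap
        · rw [if_neg hp]; exact one_dvd _
        have hx : x ≠ m := fun e => h2 y (e ▸ hp.2)
        by_cases hy : y = m
        · subst hy
          obtain rfl : x = a := hp.1.elim (fun h => hG.up_source h ha) (fun h => absurd h (hdn x))
          simp only [hp, if_true]
          exact Dvd.dvd.mul_right (by rw [← neg_sub]; exact neg_dvd.2 dvd_rfl |>.trans dvd_rfl) _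
        · refine Dvd.dvd.mul_left ?_ _
          rw [if_pos hp, if_pos]
          exact ⟨hp.1.imp (fun h => ⟨h, hx, hy⟩) (fun h => ⟨h, hx, hy⟩), (h1 x y hx hy).1 hp.2⟩
      rw [hfE]
      refine J.add_mem (arcIdeal_mul_mem (fun ω hω => ?_) hhmem) (arcIdeal_mul_mem ht' hh'mem)
      -- With `m` just before `a`, the arc `a → m` drops out and `m → b` counts exactly for the `b`
      -- not before `a`, giving `E₃`. For the other `b` the arc `b → a` counts, giving `E₁`.
      obtain ⟨ω', hω', h1, h2, h3⟩ := exists_just_before ω hω m a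
      set E₁ : Laurent K r :=
        ∏ b, if Dn m b ∧ ω b < ω a then Laurent.y c b - Laurent.y c a else 1 with hE₁
      set E₂ : Laurent K r :=
        ∏ b, if Dn m b ∧ ¬ ω b < ω a then Laurent.y c b - Laurent.y c a else 1 with hE₂
      set E₃ : Laurent K r :=
        ∏ b, if Dn m b ∧ ¬ ω b < ω a then Laurent.y c b - Laurent.y c m else 1 with hE₃
      have hE : (∏ b, if Dn m b then Laurent.y c b - Laurent.y c a else 1) = E₁ * E₂ := by
        rw [hE₁, hE₂, ← Finset.prod_mul_distrib]
        refine Finset.prod_congr rfl fun b _ => ?_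
        by_cases hb : Dn m b <;> by_cases hb' : ω b < ω a <;> simp [hb, hb']
      obtain ⟨s, hs⟩ := prod_sub_mod c m a (fun b => Dn m b ∧ ¬ ω b < ω a)
      rw [← hE₂, ← hE₃] at hs
      have hL1 : arcProd c (fun a b => Up a b ∨ Dn a b) ω' ∣
          arcProd c (fun x y => Up' x y ∨ Dn'' x y) ω * E₁ * E₃ := by
        rw [hE₁, hE₃, ← prod_ite_col a, ← prod_ite_row m, arcProd, arcProd,
          ← Finset.prod_mul_distrib, ← Finset.prod_mul_distrib]
        refine Finset.prod_dvd_prod_of_dvd _ _ fun p _ => ?_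
        obtain ⟨x, y⟩ := p
        by_cases hp : (Up x y ∨ Dn x y) ∧ ω' x < ω' y
        swap
        · rw [if_neg hp]; exact one_dvd _
        rw [if_pos hp]
        by_cases hx : x = m
        · subst hx
          have hd : Dn x y := hp.1.resolve_left (hup y)
          have := (h2 y (hbm y hd)).1 hp.2
          refine Dvd.dvd.mul_left ?_ _
          rw [if_pos rfl, if_pos ⟨hd, not_lt.2 this⟩]
          exact (dvd_neg.2 dvd_rfl).trans (by rw [neg_sub])
        · by_cases hy : y = m
          · subst hy
            obtain rfl : x = a :=
              hp.1.elim (fun h => hG.up_source h ha) (fun h => absurd h (hdn x))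
            exact absurd ((h3 x hx).1 hp.2) (lt_irrefl _)
          · have hlt := (h1 x y hx hy).1 hp.2
            refine Dvd.dvd.mul_right ?_ _
            by_cases he : y = a ∧ Dn m x
            · refine Dvd.dvd.mul_left ?_ _
              obtain ⟨rfl, hd⟩ := he
              rw [if_pos rfl, if_pos ⟨hd, hlt⟩]
            · refine Dvd.dvd.mul_right ?_ _
              rw [if_pos]
              exact ⟨hp.1.imp (fun h => ⟨h, hx, hy⟩) (fun h => ⟨⟨h, hx, hy⟩, he⟩), hlt⟩
      have hL2 : arcProd c (fun x y => Up' x y ∨ Dn' x y) ω ∣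
          arcProd c (fun x y => Up' x y ∨ Dn'' x y) ω * E₁ := by
        rw [hE₁, ← prod_ite_col a, arcProd, arcProd, ← Finset.prod_mul_distrib]
        refine Finset.prod_dvd_prod_of_dvd _ _ fun p _ => ?_
        obtain ⟨x, y⟩ := p
        by_cases hp : (Up' x y ∨ Dn' x y) ∧ ω x < ω y
        swap
        · rw [if_neg hp]; exact one_dvd _
        rw [if_pos hp]
        by_cases he : y = a ∧ Dn m x
        · refine Dvd.dvd.mul_left ?_ _
          obtain ⟨rfl, hd⟩ := he
          rw [if_pos rfl, if_pos ⟨hd, hp.2⟩]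
        · refine Dvd.dvd.mul_right ?_ _
          rw [if_pos]
          exact ⟨hp.1.imp id (fun h => ⟨h, he⟩), hp.2⟩
      obtain ⟨u, hu⟩ := hL2
      -- Replacing `E₂` by `E₃` costs a multiple of `y_m - y_a`; the factor `E₁` restores the
      -- omitted arcs `b → a`, so `ht'` covers the error.
      have : (∏ b, if Dn m b then Laurent.y c b - Laurent.y c a else 1) *
            arcProd c (fun x y => Up' x y ∨ Dn'' x y) ω =
          arcProd c (fun x y => Up' x y ∨ Dn'' x y) ω * E₁ * E₃ +
          (u * s) * ((Laurent.y c m - Laurent.y c a) *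
            arcProd c (fun x y => Up' x y ∨ Dn' x y) ω) := by
        have e : (u * s) * ((Laurent.y c m - Laurent.y c a) *
            arcProd c (fun x y => Up' x y ∨ Dn' x y) ω) =
            (arcProd c (fun x y => Up' x y ∨ Dn' x y) ω * u) *
              ((Laurent.y c m - Laurent.y c a) * s) := by ring
        rw [hE, e, ← hu, ← hs]; ring
      rw [this]
      exact J.add_mem (Ideal.mem_of_dvd _ hL1 (arcProd_mem c _ hω'))
        (J.mul_mem_left _ (ht' ω hω))
    · push Not at hc
      have hf' := ih' f fun m₁ b₁ a₁ h1 h2 => hf _ _ _ h1.1 h2.1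
      rw [← one_mul f]
      refine arcIdeal_mul_mem (fun ω hω => ?_) hf'
      -- No arc enters `m`, so in the last place it contributes no factor.
      obtain ⟨ω', hω', h1, h2⟩ := exists_last ω hω m
      refine Ideal.mem_of_dvd _ ?_ (arcProd_mem c _ hω')
      rw [one_mul, arcProd, arcProd]
      refine Finset.prod_dvd_prod_of_dvd _ _ fun p _ => ?_
      obtain ⟨x, y⟩ := p
      by_cases hp : (Up x y ∨ Dn x y) ∧ ω' x < ω' y
      swap
      · rw [if_neg hp]; exact one_dvd _
      have hx : x ≠ m := fun e => h2 y (e ▸ hp.2)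
      have hy : y ≠ m := by
        rintro rfl
        exact hp.1.elim (hc x) (hdn x)
      rw [if_pos hp, if_pos]
      exact ⟨hp.1.imp (fun h => ⟨h, hx, hy⟩) (fun h => ⟨h, hx, hy⟩), (h1 x y hx hy).1 hp.2⟩

theorem mem_arcIdeal (c : Fin r → Kˣ) {ht : Fin r → ℤ} {Up Dn : Fin r → Fin r → Prop}
    (hG : IsWheelGraph ht Up Dn) {f : Laurent K r}
    (hf : ∀ m b a, Up a m → Dn m b → Laurent.substY c (collapse m b a) f = 0) :
    f ∈ arcIdeal c (fun a b => Up a b ∨ Dn a b) :=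
  mem_arcIdeal_aux c ht _ Finset.univ Up Dn rfl (fun _ _ _ => ⟨Finset.mem_univ _, Finset.mem_univ _⟩)
    hG f hf
end WheelShuffle

/-! ### Configurations with coincident points and the power of Δ -/

namespace WheelShuffle
variable {K : Type} [Field K] {r : ℕ}

/-- The parameters `α_w` and `q` in a field, together with a height on its units for which they
are positive. -/
structure WeilData (K W : Type) [Field K] where
  /-- The Weil numbers. -/
  α : W → Kˣ
  /-- The norm of the Weil numbers. -/
  q : Kˣ
  /-- The involution of the Weil numbers. -/
  bar : W → W
  α_mul_bar : ∀ w, α w * α (bar w) = q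
  α_injective : Function.Injective α
  /-- A homomorphism to the integers. -/
  ht : Kˣ → ℤ
  ht_mul : ∀ a b, ht (a * b) = ht a + ht b
  ht_α : ∀ w, ht (α w) = 1
  ht_q : ht q = 2

namespace WeilData
variable {W : Type} (D : WeilData K W) (ρ : Fin r → Fin r) (c : Fin r → Kˣ)

theorem ht_one : D.ht 1 = 0 := by
  have := D.ht_mul 1 1
  rw [mul_one] at this
  omega

/-- The arcs that multiply the value by `q`. -/
def Up (a b : Fin r) : Prop := ρ a = ρ b ∧ c b = D.q * c a

/-- The arcs that divide the value by one of the Weil numbers. -/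
def Dn (a b : Fin r) : Prop := ρ a = ρ b ∧ ∃ w, c a = D.α w * c b

/-- The arcs of both kinds. -/
def Arc (a b : Fin r) : Prop := D.Up ρ c a b ∨ D.Dn ρ c a b

variable {D ρ c}

theorem Up.ht_eq {a b : Fin r} (h : D.Up ρ c a b) : D.ht (c b) = D.ht (c a) + 2 := by
  rw [h.2, D.ht_mul, D.ht_q, add_comm]

theorem Dn.ht_eq {a b : Fin r} (h : D.Dn ρ c a b) : D.ht (c a) = D.ht (c b) + 1 := by
  obtain ⟨w, hw⟩ := h.2
  rw [hw, D.ht_mul, D.ht_α, add_comm]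

theorem Arc.asymm {a b : Fin r} (h : D.Arc ρ c a b) (h' : D.Arc ρ c b a) : False := by
  rcases h with h | h <;> rcases h' with h' | h' <;> have := h.ht_eq <;> have := h'.ht_eq <;> omega

theorem Arc.ht_ne {a b : Fin r} (h : D.Arc ρ c a b) : D.ht (c a) ≠ D.ht (c b) := by
  rcases h with h | h <;> have := h.ht_eq <;> omega

theorem Up.close {a m b : Fin r} (h : D.Up ρ c a m) {w : W} (hw : c m = D.α w * c b) :
    c b = D.α (D.bar w) * c a := by
  have := h.2.symm.trans hw
  rw [← D.α_mul_bar w, mul_assoc] at this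
  exact (mul_left_cancel this).symm

variable (D ρ c)

/-- The condition that `f` vanishes on the wheels of the configuration `(ρ, c)`. -/
def Vanishes (f : Laurent K r) : Prop :=
  ∀ m b a w, c m = D.α w * c b → c b = D.α (D.bar w) * c a → ρ m = ρ b → ρ b = ρ a →
    Laurent.substY c (collapse m b a) f = 0

variable {D ρ c}

/-- Arcs inside the classes of `s` form a wheel graph, since each class has distinct points; arcs
between classes find their factors in the product over `F`. -/
theorem mem_arcIdeal_of_setoid (s : Setoid (Fin r))
    (hs : ∀ a b, s a b → ρ a = ρ b → c a = c b → a = b) (F : Finset (Fin r × Fin r))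
    (hF : ∀ a b, D.Arc ρ c a b → (a, b) ∈ F ∨ s a b) {f : Laurent K r} (hf : D.Vanishes ρ c f) :
    (∏ p ∈ F, (Laurent.y c p.1 - Laurent.y c p.2)) * f ∈ arcIdeal c (D.Arc ρ c) := by
  classical
  have hG : IsWheelGraph (fun a => D.ht (c a)) (fun a b => D.Up ρ c a b ∧ s a b)
      (fun a b => D.Dn ρ c a b ∧ s a b) :=
    { up_lt := fun h => by have := h.1.ht_eq; omega
      dn_lt := fun h => by have := h.1.ht_eq; omega
      up_source := fun h h' => hs _ _ (s.trans h.2 (s.symm h'.2)) (h.1.1.trans h'.1.1.symm)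
        (mul_left_cancel (h.1.2.symm.trans h'.1.2))
      up_target := fun h h' => hs _ _ (s.trans (s.symm h.2) h'.2) (h.1.1.symm.trans h'.1.1)
        (h.1.2.trans h'.1.2.symm)
      close := fun h h' => by
        obtain ⟨w, hw⟩ := h'.1.2
        exact ⟨⟨(h.1.1.trans h'.1.1).symm, _, h.1.close hw⟩, s.symm (s.trans h.2 h'.2)⟩
      not_both := fun h h' => by
        have := h.1.ht_eq
        have := h'.1.ht_eq
        omega }
  refine arcIdeal_mul_mem (fun ω hω => ?_) (mem_arcIdeal c hG fun m b a h h' => ?_)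
  · refine Ideal.mem_of_dvd _ ?_ (arcProd_mem c _ hω)
    rw [arcProd, arcProd, ← Fintype.prod_ite_mem F, ← Finset.prod_mul_distrib]
    refine Finset.prod_dvd_prod_of_dvd _ _ fun p _ => ?_
    by_cases hp : D.Arc ρ c p.1 p.2 ∧ ω p.1 < ω p.2
    swap
    · rw [if_neg hp]; exact one_dvd _
    rw [if_pos hp]
    rcases hF _ _ hp.1 with h | h
    · rw [if_pos h]; exact dvd_mul_right _ _
    · refine Dvd.dvd.mul_left ?_ _
      rw [if_pos ⟨hp.1.imp (fun h' => ⟨h', h⟩) (fun h' => ⟨h', h⟩), hp.2⟩]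
  · obtain ⟨w, hw⟩ := h'.1.2
    exact hf m b a w hw (h.1.close hw) h'.1.1 (h.1.1.trans h'.1.1).symm

theorem mem_arcIdeal_of_injective (hs : ∀ a b, ρ a = ρ b → c a = c b → a = b) {f : Laurent K r}
    (hf : D.Vanishes ρ c f) : f ∈ arcIdeal c (D.Arc ρ c) := by
  simpa using mem_arcIdeal_of_setoid (D := D) ⊤ (fun a b _ => hs a b) ∅
    (fun _ _ _ => Or.inr trivial) hf
end WeilData

theorem x_sub_dvd_vandermonde {a b : Fin r} (h : a ≠ b) :
    (Laurent.x K r a : Laurent K r) - Laurent.x K r b ∣ vandermonde K r := by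
  wlog hab : a < b generalizing a b
  · rw [← neg_sub, neg_dvd]
    exact this h.symm (lt_of_le_of_ne (not_lt.1 hab) h.symm)
  exact (Finset.dvd_prod_of_mem (fun j => (Laurent.x K r a : Laurent K r) - Laurent.x K r j)
    (Finset.mem_Ioi.2 hab)).trans (Finset.dvd_prod_of_mem (fun i => ∏ j ∈ Finset.Ioi i,
      ((Laurent.x K r i : Laurent K r) - (Laurent.x K r j : Laurent K r))) (Finset.mem_univ a))

theorem y_sub_dvd_vandermonde {c : Fin r → Kˣ} {a b : Fin r} (h : a ≠ b) (hc : c a = c b) :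
    Laurent.y c a - Laurent.y c b ∣ vandermonde K r := by
  refine dvd_trans ?_ (x_sub_dvd_vandermonde h)
  rw [Laurent.x_eq_smul_y c a, Laurent.x_eq_smul_y c b, hc, ← smul_sub, Algebra.smul_def]
  exact dvd_mul_left _ _

namespace WeilData
variable {W : Type} {D : WeilData K W} {ρ : Fin r → Fin r} {c : Fin r → Kˣ}

/-- Descending induction on `F`. Let I be generated by the differences of the arcs outside `F`, and
call a, b equivalent if y_a - y_b ∈ I. If equivalent points are distinct, no Δ is needed. Otherwise
some y_a - y_b ∈ I with c a = c b divides Δ, so Δ ∈ I, and each generator of I is absorbed by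
enlarging `F`. -/
theorem vandermonde_pow_mul_mem_aux (n : ℕ) {E : Finset (Fin r × Fin r)}
    (hE : ∀ a b, D.Arc ρ c a b → (a, b) ∈ E) {f : Laurent K r} (hf : D.Vanishes ρ c f) :
    ∀ F ⊆ E, (E \ F).card = n → vandermonde K r ^ n *
      ((∏ p ∈ F, (Laurent.y c p.1 - Laurent.y c p.2)) * f) ∈ arcIdeal c (D.Arc ρ c) := by
  classical
  induction n with
  | zero =>
    intro F hF hn
    rw [pow_zero, one_mul]
    refine mem_arcIdeal_of_setoid ⊥ (fun a b h _ _ => h) F (fun a b h => Or.inl ?_) hf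
    rw [Finset.card_eq_zero, Finset.sdiff_eq_empty_iff_subset] at hn
    exact hn (hE a b h)
  | succ n ih =>
    intro F hF hn
    set I : Ideal (Laurent K r) :=
      Ideal.span ((fun p : Fin r × Fin r => Laurent.y c p.1 - Laurent.y c p.2) ''
        ((E \ F : Finset (Fin r × Fin r)) : Set (Fin r × Fin r))) with hI
    let s : Setoid (Fin r) :=
      { r := fun a b => Laurent.y c a - Laurent.y c b ∈ I
        iseqv := ⟨fun a => by simp, fun h => by rw [← neg_sub]; exact I.neg_mem h,
          fun h h' => by simpa using I.add_mem h h'⟩ }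
    by_cases hs : ∀ a b, s a b → ρ a = ρ b → c a = c b → a = b
    · refine Ideal.mul_mem_left _ _ (mem_arcIdeal_of_setoid s hs F (fun a b h => ?_) hf)
      by_cases hab : (a, b) ∈ F
      · exact Or.inl hab
      · exact Or.inr (Ideal.subset_span ⟨(a, b), by simp [hab, hE a b h], rfl⟩)
    · push Not at hs
      obtain ⟨a, b, h, -, hc, hab⟩ := hs
      set X := vandermonde K r ^ n * ((∏ p ∈ F, (Laurent.y c p.1 - Laurent.y c p.2)) * f) with hX
      have hIX : I ≤ Submodule.comap (LinearMap.mulRight (Laurent K r) X)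
          (arcIdeal c (D.Arc ρ c)) := by
        rw [hI, Ideal.span_le]
        rintro _ ⟨p, hp, rfl⟩
        obtain ⟨hpE, hpF⟩ := Finset.mem_sdiff.1 (Finset.mem_coe.1 hp)
        have := ih (insert p F) (Finset.insert_subset hpE hF) (by
          rw [Finset.sdiff_insert, Finset.card_erase_of_mem (Finset.mem_sdiff.2 ⟨hpE, hpF⟩), hn]
          rfl)
        rw [Finset.prod_insert hpF] at this
        change _ * X ∈ arcIdeal c (D.Arc ρ c)
        convert this using 1
        rw [hX]; ring
      have : vandermonde K r ∈ I := Ideal.mem_of_dvd _ (y_sub_dvd_vandermonde hab hc) h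
      have h2 : vandermonde K r * X ∈ arcIdeal c (D.Arc ρ c) := hIX this
      rwa [pow_succ', mul_assoc]

/-- The `+ 1` is available because Δ is needed only when two points coincide, and this pair carries
no arc. Every other pair carries at most one, as opposite arcs contradict the heights. -/
theorem vandermonde_pow_mul_mem {f : Laurent K r} (hf : D.Vanishes ρ c f) {N : ℕ}
    (hN : r.choose 2 ≤ N + 1) : vandermonde K r ^ N * f ∈ arcIdeal c (D.Arc ρ c) := by
  classical
  by_cases hs : ∀ a b, ρ a = ρ b → c a = c b → a = b
  · exact Ideal.mul_mem_left _ _ (mem_arcIdeal_of_injective hs hf)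
  push Not at hs
  obtain ⟨a, b, hρ, hc, hab⟩ := hs
  set E := Finset.univ.filter fun p : Fin r × Fin r => D.Arc ρ c p.1 p.2
  have hE : ∀ a b, D.Arc ρ c a b → (a, b) ∈ E := fun a b h => by simpa [E] using h
  have hcard : E.card + 1 ≤ r.choose 2 := by
    set P := (Finset.univ : Finset (Fin r)).powersetCard 2
    have hP : P.card = r.choose 2 := by simp [P]
    have hne : ∀ p ∈ E, p.1 ≠ p.2 := fun p hp h => by
      have : D.Arc ρ c p.1 p.2 := by simpa [E] using hp
      exact this.ht_ne (by rw [h])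
    have hmaps : ∀ p ∈ E, ({p.1, p.2} : Finset (Fin r)) ∈ P.erase {a, b} := by
      intro p hp
      have hA : D.Arc ρ c p.1 p.2 := by simpa [E] using hp
      refine Finset.mem_erase.2 ⟨fun h => ?_, by
        simp [P, Finset.mem_powersetCard, Finset.card_pair (hne p hp)]⟩
      have h1 : p.1 ∈ ({a, b} : Finset (Fin r)) := h ▸ by simp
      have h2 : p.2 ∈ ({a, b} : Finset (Fin r)) := h ▸ by simp
      have h3 : ∀ i ∈ ({a, b} : Finset (Fin r)), c i = c a := by simp [hc]
      exact hA.ht_ne (by rw [h3 _ h1, h3 _ h2])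
    have hinj : Set.InjOn (fun p : Fin r × Fin r => ({p.1, p.2} : Finset (Fin r))) E := by
      rintro ⟨i, j⟩ hp ⟨k, l⟩ hp' h
      have hA : D.Arc ρ c i j := by simpa [E] using hp
      have hA' : D.Arc ρ c k l := by simpa [E] using hp'
      have h1 : i ∈ ({k, l} : Finset (Fin r)) := by
        rw [← show ({i, j} : Finset (Fin r)) = {k, l} from h]; simp
      have h2 : j ∈ ({k, l} : Finset (Fin r)) := by
        rw [← show ({i, j} : Finset (Fin r)) = {k, l} from h]; simp
      simp only [Finset.mem_insert, Finset.mem_singleton] at h1 h2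
      rcases h1 with rfl | rfl <;> rcases h2 with rfl | rfl
      · exact absurd rfl hA.ht_ne
      · rfl
      · exact (hA.asymm hA').elim
      · exact absurd rfl hA.ht_ne
    have := Finset.card_le_card_of_injOn _ hmaps hinj
    have hm : ({a, b} : Finset (Fin r)) ∈ P := by
      simp [P, Finset.mem_powersetCard, Finset.card_pair hab]
    rw [Finset.card_erase_of_mem hm, hP] at this
    have : 0 < r.choose 2 := hP ▸ Finset.card_pos.2 ⟨_, hm⟩
    omega
  have := vandermonde_pow_mul_mem_aux _ hE hf ∅ (Finset.empty_subset _) rfl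
  rw [Finset.prod_empty, one_mul, Finset.sdiff_empty] at this
  rw [show N = (N - E.card) + E.card by omega, pow_add, mul_assoc]
  exact Ideal.mul_mem_left _ _ this
end WeilData

/-- This is where the exponent of the theorem enters; equality holds for r = 2 and r = 3. -/
theorem choose_two_le (r : ℕ) : r.choose 2 ≤ 2 * (r.factorial / 4) + 1 := by
  rcases lt_or_ge r 4 with h | h
  · interval_cases r <;> decide
  · obtain ⟨n, rfl⟩ := Nat.exists_eq_add_of_le' h
    have h1 : 2 ≤ (n + 2).factorial := Nat.self_le_factorial 2 |>.trans
      (Nat.factorial_le (by omega))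
    have h2 : (n + 4).factorial = ((n + 4) * (n + 3)) * (n + 2).factorial := by
      rw [Nat.factorial_succ, Nat.factorial_succ, mul_assoc]
    have h3 := Nat.mul_le_mul_left ((n + 4) * (n + 3)) h1
    rw [Nat.choose_two_right, h2, show n + 4 - 1 = n + 3 by omega]
    omega
end WheelShuffle

/-! ### Comparison with the numerators at a prime ideal -/

namespace WheelShuffle
variable {K : Type} [Field K] {r : ℕ}

/-- A prime ideal determines which of the ratios of the variables become constants of `K`. -/
theorem exists_chart (𝔪 : Ideal (Laurent K r)) [𝔪.IsPrime] :
    ∃ (ρ : Fin r → Fin r) (c : Fin r → Kˣ), ∀ (a b : Fin r) (γ : Kˣ),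
      (Laurent.x K r a : Laurent K r) - (γ : K) • (Laurent.x K r b : Laurent K r) ∈ 𝔪 ↔
        ρ a = ρ b ∧ c a = γ * c b := by
  have hx : ∀ a (γ : K), γ • (Laurent.x K r a : Laurent K r) ∈ 𝔪 → γ = 0 := by
    intro a γ h
    by_contra h0
    refine (Ideal.IsPrime.ne_top ‹_›) (Ideal.eq_top_of_isUnit_mem 𝔪 h ?_)
    rw [Algebra.smul_def]
    exact ((isUnit_iff_ne_zero.2 h0).map (algebraMap K (Laurent K r))).mul (Laurent.x K r a).isUnit
  let R : Fin r → Fin r → Kˣ → Prop := fun a b γ =>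
    (Laurent.x K r a : Laurent K r) - (γ : K) • (Laurent.x K r b : Laurent K r) ∈ 𝔪
  have hrefl : ∀ a, R a a 1 := fun a => by simp [R]
  have hsymm : ∀ a b γ, R a b γ → R b a γ⁻¹ := fun a b γ h => by
    have := 𝔪.neg_mem (Submodule.smul_of_tower_mem 𝔪 ((γ⁻¹ : Kˣ) : K) h)
    rwa [smul_sub, smul_smul, Units.inv_mul, one_smul, neg_sub] at this
  have htrans : ∀ a b d γ δ, R a b γ → R b d δ → R a d (γ * δ) := fun a b d γ δ h h' => by
    have := 𝔪.add_mem h (Submodule.smul_of_tower_mem 𝔪 (γ : K) h')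
    rwa [smul_sub, smul_smul, sub_add_sub_cancel, ← Units.val_mul] at this
  have huniq : ∀ a b γ δ, R a b γ → R a b δ → γ = δ := fun a b γ δ h h' => by
    have := 𝔪.sub_mem h h'
    rw [sub_sub_sub_cancel_left, ← sub_smul] at this
    exact (Units.ext (sub_eq_zero.1 (hx b _ this))).symm
  -- `K` need not be algebraically closed, so only some ratios x_a / x_b are constants modulo 𝔪.
  -- Then `ρ` picks a representative of each class, and `c a` is the constant x_a / x_{ρ a}.
  let s : Setoid (Fin r) :=
    { r := fun a b => ∃ γ, R a b γ
      iseqv := ⟨fun a => ⟨1, hrefl a⟩, fun ⟨γ, h⟩ => ⟨γ⁻¹, hsymm _ _ _ h⟩,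
        fun ⟨γ, h⟩ ⟨δ, h'⟩ => ⟨γ * δ, htrans _ _ _ _ _ h h'⟩⟩ }
  let ρ : Fin r → Fin r := fun a => (Quotient.mk s a).out
  have hρ : ∀ a, ∃ γ, R a (ρ a) γ := fun a => Quotient.exact (s := s) (Quotient.out_eq _).symm
  choose c hc using hρ
  refine ⟨ρ, c, fun a b γ => ⟨fun h => ?_, fun ⟨h, h'⟩ => ?_⟩⟩
  · have e : ρ a = ρ b := congrArg Quotient.out (Quotient.sound (s := s) ⟨γ, h⟩)
    exact ⟨e, huniq a (ρ a) _ _ (hc a) (e ▸ htrans _ _ _ _ _ h (hc b))⟩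
  · have h1 := htrans _ _ _ _ _ (h ▸ hc a : R a (ρ b) (c a)) (hsymm _ _ _ (hc b))
    rwa [h', mul_inv_cancel_right] at h1

namespace WeilData
variable {W : Type} [Fintype W] (D : WeilData K W)

/-- The numerator of the kernel of the shuffle product at `x_a / x_b`. -/
def factor (a b : Fin r) : Laurent K r :=
  ((Laurent.x K r b : Laurent K r) - (D.q : K) • (Laurent.x K r a : Laurent K r)) *
    ∏ w, ((Laurent.x K r a : Laurent K r) - (D.α w : K) • (Laurent.x K r b : Laurent K r))

/-- The product of the numerators over all pairs, ordered by the permutation `σ`. -/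
def numer (r : ℕ) (σ : Equiv.Perm (Fin r)) : Laurent K r :=
  ∏ i, ∏ j ∈ Finset.Ioi i, D.factor (σ i) (σ j)

/-- The ideal generated by the permuted numerators. -/
def numerIdeal (r : ℕ) : Ideal (Laurent K r) := Ideal.span (Set.range (D.numer r))

open Classical in
-- At most one linear factor lies in 𝔪: the factor with q and one with a Weil number would need
-- incompatible heights, and two Weil numbers are excluded by injectivity of `α`.
theorem factor_eq (𝔪 : Ideal (Laurent K r)) [h𝔪 : 𝔪.IsPrime] {ρ : Fin r → Fin r} {c : Fin r → Kˣ}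
    (hc : ∀ (a b : Fin r) (γ : Kˣ),
      (Laurent.x K r a : Laurent K r) - (γ : K) • (Laurent.x K r b : Laurent K r) ∈ 𝔪 ↔
        ρ a = ρ b ∧ c a = γ * c b) (a b : Fin r) :
    ∃ s, s ∉ 𝔪 ∧ D.factor a b =
      s * if D.Arc ρ c a b then Laurent.y c a - Laurent.y c b else 1 := by
  have hunit : ∀ k : Kˣ, algebraMap K (Laurent K r) k ∉ 𝔪 := fun k h =>
    h𝔪.ne_top (Ideal.eq_top_of_isUnit_mem 𝔪 h (k.isUnit.map (algebraMap K (Laurent K r))))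
  by_cases hA : D.Arc ρ c a b
  · rw [if_pos hA]
    rcases hA with h | h
    · refine ⟨algebraMap K _ ((-1 * c b : Kˣ) : K) *
        ∏ w, ((Laurent.x K r a : Laurent K r) - (D.α w : K) • (Laurent.x K r b : Laurent K r)),
        fun hm => ?_, ?_⟩
      · rcases h𝔪.mem_or_mem hm with hm | hm
        · exact hunit _ hm
        · obtain ⟨w, -, hw⟩ := (Ideal.IsPrime.prod_mem_iff).1 hm
          have h1 := h.ht_eq
          have h2 := Dn.ht_eq (D := D) (ρ := ρ) ⟨h.1, w, ((hc _ _ _).1 hw).2⟩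
          omega
      · have : (Laurent.x K r b : Laurent K r) - (D.q : K) • (Laurent.x K r a : Laurent K r) =
            algebraMap K _ (c b : K) * (Laurent.y c b - Laurent.y c a) := by
          rw [Laurent.x_eq_smul_y c a, Laurent.x_eq_smul_y c b, smul_smul, ← Units.val_mul, ← h.2,
            ← smul_sub, Algebra.smul_def]
        rw [factor, this, Units.val_mul, map_mul, Units.val_neg, Units.val_one, map_neg, map_one]
        ring
    · obtain ⟨w, hw⟩ := h.2
      refine ⟨algebraMap K _ (c a : K) *
        (((Laurent.x K r b : Laurent K r) - (D.q : K) • (Laurent.x K r a : Laurent K r)) *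
        ∏ w ∈ Finset.univ.erase w,
          ((Laurent.x K r a : Laurent K r) - (D.α w : K) • (Laurent.x K r b : Laurent K r))),
        fun hm => ?_, ?_⟩
      · rcases h𝔪.mem_or_mem hm with hm | hm
        · exact hunit _ hm
        rcases h𝔪.mem_or_mem hm with hm | hm
        · have h1 := h.ht_eq
          have h2 := Up.ht_eq (D := D) (ρ := ρ) ⟨h.1, ((hc _ _ _).1 hm).2⟩
          omega
        · obtain ⟨w', hw', hm⟩ := (Ideal.IsPrime.prod_mem_iff).1 hm
          exact (Finset.mem_erase.1 hw').1
            (D.α_injective (mul_right_cancel (((hc _ _ _).1 hm).2.symm.trans hw)))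
      · rw [factor, ← Finset.mul_prod_erase _ _ (Finset.mem_univ w)]
        have : (Laurent.x K r a : Laurent K r) - (D.α w : K) • (Laurent.x K r b : Laurent K r) =
            algebraMap K _ (c a : K) * (Laurent.y c a - Laurent.y c b) := by
          rw [Laurent.x_eq_smul_y c a, Laurent.x_eq_smul_y c b, smul_smul, ← Units.val_mul, ← hw,
            ← smul_sub, Algebra.smul_def]
        rw [this]; ring
  · refine ⟨_, fun hm => hA ?_, by rw [if_neg hA, mul_one]⟩
    rcases h𝔪.mem_or_mem hm with hm | hm
    · have := (hc _ _ _).1 hm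
      exact Or.inl ⟨this.1.symm, this.2⟩
    · obtain ⟨w, -, hw⟩ := (Ideal.IsPrime.prod_mem_iff).1 hm
      have := (hc _ _ _).1 hw
      exact Or.inr ⟨this.1, w, this.2⟩

theorem exists_perm_of_injective (ω : Fin r → ℤ) (hω : Function.Injective ω) :
    ∃ σ : Equiv.Perm (Fin r), ∀ i j, i < j ↔ ω (σ i) < ω (σ j) :=
  ⟨Tuple.sort ω, fun _ _ => (((Tuple.monotone_sort ω).strictMono_of_injective
    (hω.comp (Tuple.sort ω).injective)).lt_iff_lt).symm⟩

theorem prod_Ioi_perm (F : Fin r → Fin r → Laurent K r) (ω : Fin r → ℤ)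
    (σ : Equiv.Perm (Fin r)) (h : ∀ i j, i < j ↔ ω (σ i) < ω (σ j)) :
    ∏ i, ∏ j ∈ Finset.Ioi i, F (σ i) (σ j) =
      ∏ p : Fin r × Fin r, if ω p.1 < ω p.2 then F p.1 p.2 else 1 := by
  rw [← Equiv.prod_comp (Equiv.prodCongr σ σ), Fintype.prod_prod_type]
  refine Finset.prod_congr rfl fun i _ => ?_
  rw [← Finset.filter_lt_eq_Ioi, Finset.prod_filter]
  exact Finset.prod_congr rfl fun j _ => by simp [h]

/-- For the permutation that sorts ω, the numerator is the arc product of ω times elements outside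
𝔪. The multiplier collects these over all ordered pairs, so that one choice serves every ω. -/
theorem exists_mul_mem_numerIdeal (𝔪 : Ideal (Laurent K r)) [h𝔪 : 𝔪.IsPrime]
    {ρ : Fin r → Fin r} {c : Fin r → Kˣ}
    (hc : ∀ (a b : Fin r) (γ : Kˣ),
      (Laurent.x K r a : Laurent K r) - (γ : K) • (Laurent.x K r b : Laurent K r) ∈ 𝔪 ↔
        ρ a = ρ b ∧ c a = γ * c b) :
    ∃ s ∉ 𝔪, ∀ f ∈ arcIdeal c (D.Arc ρ c), s * f ∈ D.numerIdeal r := by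
  classical
  choose s hs hsf using D.factor_eq 𝔪 hc
  refine ⟨∏ p : Fin r × Fin r, s p.1 p.2, fun h => ?_, fun f hf =>
    arcIdeal_mul_mem (fun ω hω => ?_) hf⟩
  · obtain ⟨p, -, hp⟩ := (Ideal.IsPrime.prod_mem_iff).1 h
    exact hs _ _ hp
  · obtain ⟨σ, hσ⟩ := exists_perm_of_injective ω hω
    refine Ideal.mem_of_dvd _ ?_ (Ideal.subset_span ⟨σ, rfl⟩)
    rw [numer, prod_Ioi_perm D.factor ω σ hσ, arcProd, ← Finset.prod_mul_distrib]
    refine Finset.prod_dvd_prod_of_dvd _ _ fun p _ => ?_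
    by_cases hp : ω p.1 < ω p.2
    · rw [if_pos hp, hsf]
      simp [hp]
    · rw [if_neg hp]; exact one_dvd _

/-- A Laurent polynomial that vanishes on the wheels lies in the ideal of the permuted numerators,
up to a power of the Vandermonde determinant. -/
theorem vandermonde_pow_mul_mem_numerIdeal [CharZero K] {f : Laurent K r}
    (hf : ∀ (z : Fin r → Kˣ) (w : W) (i j k : Fin r), i ≠ j → j ≠ k → i ≠ k →
      z i = D.α w * z j → z j = D.α (D.bar w) * z k → Laurent.eval z f = 0) :
    vandermonde K r ^ (2 * (r.factorial / 4)) * f ∈ D.numerIdeal r := by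
  by_contra hmem
  set g := vandermonde K r ^ (2 * (r.factorial / 4)) * f
  -- The multipliers that bring `g` into the ideal form a proper ideal if the claim fails; a maximal
  -- ideal above it would contain the local multiplier `s`.
  let I : Ideal (Laurent K r) :=
    Submodule.comap (LinearMap.mulRight (Laurent K r) g) (D.numerIdeal r)
  obtain ⟨𝔪, h𝔪, hI⟩ := I.exists_le_maximal fun h => hmem <| by
    have : (1 : Laurent K r) ∈ I := h ▸ Submodule.mem_top
    simpa [I] using this
  have := h𝔪.isPrime
  obtain ⟨ρ, c, hc⟩ := exists_chart 𝔪
  obtain ⟨s, hs, hsJ⟩ := D.exists_mul_mem_numerIdeal 𝔪 hc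
  refine hs (hI (hsJ _ (vandermonde_pow_mul_mem (fun m b a w hmb hba _ _ => ?_)
    (choose_two_le r))))
  have h1 : D.ht (c m) = D.ht (c b) + 1 := by rw [hmb, D.ht_mul, D.ht_α, add_comm]
  have h2 : D.ht (c b) = D.ht (c a) + 1 := by rw [hba, D.ht_mul, D.ht_α, add_comm]
  have n1 : m ≠ b := by rintro rfl; omega
  have n2 : b ≠ a := by rintro rfl; omega
  have n3 : m ≠ a := by rintro rfl; omega
  -- Evaluating after the collapse amounts to evaluating `f` at a point of the wheel locus.
  refine Laurent.eq_zero_of_eval _ fun z => ?_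
  have : (Laurent.eval z : Laurent K r →ₐ[K] K).comp (Laurent.substY c (collapse m b a)) =
      Laurent.eval fun i => c i / c (collapse m b a i) * z (collapse m b a i) :=
    Laurent.algHom_ext fun i => by simp [Laurent.substY]
  refine (DFunLike.congr_fun this f).trans (hf _ w m b a n1 n2 n3 ?_ ?_)
  · simp [collapse, hmb, mul_div_assoc, mul_assoc]
  · simp [collapse, n3.symm, n2.symm, hba]
end WeilData
end WheelShuffle

/-! ### Alternating sums and the ideal of weighted symmetrizations -/

namespace WheelShuffle
variable {K : Type} [Field K] {r : ℕ}

/-- The permutation `x_i ↦ x_{σ i}` of the variables of a Laurent polynomial. -/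
abbrev Laurent.perm (σ : Equiv.Perm (Fin r)) : Laurent K r →ₐ[K] Laurent K r :=
  Laurent.eval fun i => Laurent.x K r (σ i)

theorem Laurent.perm_perm (σ τ : Equiv.Perm (Fin r)) (f : Laurent K r) :
    Laurent.perm σ (Laurent.perm τ f) = Laurent.perm (σ * τ) f := by
  have : (Laurent.perm (K := K) σ).comp (Laurent.perm τ) = Laurent.perm (σ * τ) :=
    Laurent.algHom_ext fun i => by simp
  exact DFunLike.congr_fun this f

theorem Laurent.perm_one (f : Laurent K r) : Laurent.perm 1 f = f := by
  have : Laurent.perm (K := K) (r := r) 1 = AlgHom.id K _ :=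
    Laurent.algHom_ext fun i => by simp
  exact DFunLike.congr_fun this f

theorem mem_symLaurent {f : Laurent K r} :
    f ∈ SymLaurent K r ↔ ∀ σ, Laurent.perm σ f = f := by
  simp [SymLaurent, Algebra.mem_iInf, AlgHom.mem_equalizer]

theorem perm_vandermonde (σ : Equiv.Perm (Fin r)) :
    Laurent.perm σ (vandermonde K r) = (σ.sign : ℤ) * vandermonde K r := by
  simp only [vandermonde, map_prod, map_sub, Laurent.eval_x]
  exact σ.prod_Ioi_comp_eq_sign_mul_prod
    (f := fun i j => (Laurent.x K r i : Laurent K r) - (Laurent.x K r j : Laurent K r))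
    fun i j => by ring

theorem x_sub_ne_zero {a b : Fin r} (h : a ≠ b) :
    (Laurent.x K r a : Laurent K r) - (Laurent.x K r b : Laurent K r) ≠ 0 := by
  simpa using Laurent.smul_x_sub_ne_zero (K := K) (u := 1) (v := 1) one_ne_zero
    fun e => absurd e h

theorem vandermonde_ne_zero : vandermonde K r ≠ 0 :=
  Finset.prod_ne_zero_iff.2 fun _ _ => Finset.prod_ne_zero_iff.2 fun _ h =>
    x_sub_ne_zero (Finset.mem_Ioi.1 h).ne

theorem vandermonde_eq : vandermonde K r =
    ∏ p ∈ Finset.univ.filter (fun p : Fin r × Fin r => p.1 < p.2),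
      ((Laurent.x K r p.1 : Laurent K r) - (Laurent.x K r p.2 : Laurent K r)) := by
  rw [vandermonde, Finset.prod_filter, Fintype.prod_prod_type]
  refine Finset.prod_congr rfl fun i _ => ?_
  rw [← Finset.filter_lt_eq_Ioi, Finset.prod_filter]

/-- The alternating sum of the permutations of a Laurent polynomial. -/
def alt (Q : Laurent K r) : Laurent K r :=
  ∑ σ : Equiv.Perm (Fin r), ((σ.sign : ℤ) : Laurent K r) * Laurent.perm σ Q

theorem perm_alt (τ : Equiv.Perm (Fin r)) (Q : Laurent K r) :
    Laurent.perm τ (alt Q) = (τ.sign : ℤ) * alt Q := by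
  rw [alt, map_sum, Finset.mul_sum, ← Equiv.sum_comp (Equiv.mulLeft τ⁻¹)]
  refine Finset.sum_congr rfl fun σ _ => ?_
  rw [map_mul, map_intCast, Laurent.perm_perm, Equiv.coe_mulLeft, mul_inv_cancel_left, map_mul,
    Equiv.Perm.sign_inv, Units.val_mul, Int.cast_mul, mul_assoc]

theorem mul_alt {s : Laurent K r} (hs : s ∈ SymLaurent K r) (Q : Laurent K r) :
    s * alt Q = alt (s * Q) := by
  rw [alt, alt, Finset.mul_sum]
  refine Finset.sum_congr rfl fun σ _ => ?_
  rw [map_mul, mem_symLaurent.1 hs σ]; ring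

/-- After x_i is replaced by x_j, swapping the two has no effect, so the value equals its negative
and is zero. -/
theorem vandermonde_dvd_alt [CharZero K] (Q : Laurent K r) : vandermonde K r ∣ alt Q := by
  have hy : ∀ a, Laurent.y (K := K) (r := r) 1 a = Laurent.x K r a := fun a => by simp [Laurent.y]
  have := Laurent.prod_sub_dvd (K := K) (r := r) 1
    (Finset.univ.filter (fun p : Fin r × Fin r => p.1 < p.2)) (f := alt Q) (by
      rintro ⟨i, j⟩ hp
      have hij : i < j := by simpa using hp
      have h1 : (Laurent.substY (K := K) 1 (Function.update id i j)).comp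
          (Laurent.perm (Equiv.swap i j)) = Laurent.substY 1 (Function.update id i j) := by
        refine Laurent.algHom_ext_y 1 fun k => ?_
        have : Laurent.perm (Equiv.swap i j) (Laurent.y (K := K) 1 k) =
            Laurent.y 1 (Equiv.swap i j k) := by rw [hy, hy, Laurent.eval_x]
        rw [AlgHom.comp_apply, this, Laurent.substY_y, Laurent.substY_y]
        congr 1
        by_cases hi : k = i
        · subst hi; simp [hij.ne']
        · by_cases hj : k = j
          · subst hj; simp [hi]
          · rw [Equiv.swap_apply_of_ne_of_ne hi hj]
      have h2 := DFunLike.congr_fun h1 (alt Q)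
      rw [AlgHom.comp_apply, perm_alt, Equiv.Perm.sign_swap hij.ne, map_mul, map_intCast] at h2
      have h3 : (2 : K) • Laurent.substY (K := K) 1 (Function.update id i j) (alt Q) = 0 := by
        rw [two_smul]
        nth_rw 1 [← h2]
        simp
      exact (smul_eq_zero.1 h3).resolve_left two_ne_zero) (by
      rintro ⟨i, j⟩ hp ⟨k, l⟩ hp' hne
      have hij : i < j := by simpa using hp
      have hkl : k < l := by simpa using hp'
      simp only [Function.update_apply, id]
      split_ifs with h1 h2 h2
      · omega
      · subst h1
        exact fun e => hne (by rw [e])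
      · omega
      · exact hkl.ne)
  simpa only [hy, ← vandermonde_eq] using this

variable (N : Laurent K r)

/-- The ideal of the symmetric Laurent polynomials that are the weighted symmetrization of a
Laurent polynomial, for the weight `N / Δ`. -/
def symIdeal : Ideal (SymLaurent K r) where
  carrier := {f | ∃ P, vandermonde K r * (f : Laurent K r) = alt (N * P)}
  add_mem' := by
    rintro a b ⟨P, hP⟩ ⟨Q, hQ⟩
    refine ⟨P + Q, ?_⟩
    rw [Subalgebra.coe_add, mul_add, hP, hQ, mul_add]
    simp [alt, mul_add, Finset.sum_add_distrib]
  zero_mem' := ⟨0, by simp [alt]⟩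
  smul_mem' := by
    rintro s a ⟨P, hP⟩
    refine ⟨s * P, ?_⟩
    rw [smul_eq_mul, Subalgebra.coe_mul, mul_left_comm, hP, mul_alt s.2, mul_left_comm]

variable {N}

theorem exists_mem_symIdeal [CharZero K] (N P : Laurent K r) :
    ∃ f ∈ symIdeal N, vandermonde K r * (f : Laurent K r) = alt (N * P) := by
  obtain ⟨f, hf⟩ := vandermonde_dvd_alt (N * P)
  refine ⟨⟨f, mem_symLaurent.2 fun σ => ?_⟩, ⟨P, hf.symm⟩, hf.symm⟩
  have h := perm_alt σ (N * P)
  rw [hf, map_mul, perm_vandermonde, mul_assoc] at h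
  have h0 : ((σ.sign : ℤ) : Laurent K r) * ((σ.sign : ℤ) : Laurent K r) = 1 := by
    rw [← Int.cast_mul, ← Units.val_mul, Int.units_mul_self, Units.val_one, Int.cast_one]
  have h' := congrArg (((σ.sign : ℤ) : Laurent K r) * ·) h
  simp only [← mul_assoc, h0, one_mul] at h'
  exact mul_left_cancel₀ vandermonde_ne_zero h'

theorem eq_one_of_forall_le (σ : Equiv.Perm (Fin r)) (h : ∀ i, σ i ≤ i) : σ = 1 := by
  have h1 : ∑ i, ((σ i : Fin r) : ℕ) = ∑ i : Fin r, (i : ℕ) :=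
    Equiv.sum_comp σ (fun i : Fin r => (i : ℕ))
  rw [Finset.sum_eq_sum_iff_of_le (fun i _ => Fin.le_def.1 (h i))] at h1
  exact Equiv.ext fun i => Fin.ext (h1 i (Finset.mem_univ i))

/-- The ideal of all Laurent polynomials that is generated by `symIdeal`. -/
def extIdeal (N : Laurent K r) : Ideal (Laurent K r) :=
  Ideal.span ((fun f : SymLaurent K r => (f : Laurent K r)) '' symIdeal N)

/-- Each new factor x_{σ i} - x_j is split: x_{σ i} is σ applied to x_i and goes into `P`, while x_j
does not depend on σ and leaves the sum. -/
theorem exists_interpolation [CharZero K] (N : Laurent K r) (T : Finset (Fin r × Fin r)) :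
    ∀ P, ∃ h ∈ extIdeal N, vandermonde K r * h = ∑ σ : Equiv.Perm (Fin r),
      ((σ.sign : ℤ) : Laurent K r) * Laurent.perm σ (N * P) *
        ∏ p ∈ T, ((Laurent.x K r (σ p.1) : Laurent K r) - Laurent.x K r p.2) := by
  classical
  induction T using Finset.induction_on with
  | empty =>
    intro P
    obtain ⟨f, hf, h⟩ := exists_mem_symIdeal N P
    exact ⟨f, Ideal.subset_span ⟨f, hf, rfl⟩, by simpa [alt] using h⟩
  | insert p T hp ih =>
    intro P
    obtain ⟨h₁, hm₁, e₁⟩ := ih (P * Laurent.x K r p.1)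
    obtain ⟨h₂, hm₂, e₂⟩ := ih P
    refine ⟨h₁ - Laurent.x K r p.2 * h₂, Ideal.sub_mem _ hm₁ (Ideal.mul_mem_left _ _ hm₂), ?_⟩
    rw [mul_sub, mul_left_comm, e₁, e₂, Finset.mul_sum, ← Finset.sum_sub_distrib]
    refine Finset.sum_congr rfl fun σ _ => ?_
    rw [Finset.prod_insert hp, ← mul_assoc N, map_mul, Laurent.eval_x]
    ring

/-- Interpolate with all pairs i < j. The product of the x_{σ i} - x_j contains a zero unless σ i ≤
i for all i, that is σ = 1, where it is Δ. -/
theorem mem_extIdeal [CharZero K] (N : Laurent K r) : N ∈ extIdeal N := by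
  obtain ⟨h, hm, e⟩ := exists_interpolation N
    (Finset.univ.filter fun p : Fin r × Fin r => p.1 < p.2) 1
  rw [Finset.sum_eq_single 1] at e
  · rw [Equiv.Perm.sign_one, Laurent.perm_one] at e
    simp only [Equiv.Perm.one_apply, ← vandermonde_eq] at e
    have e' : vandermonde K r * h = vandermonde K r * N := by
      rw [e, Units.val_one, Int.cast_one, one_mul, mul_one]
      exact mul_comm _ _
    rwa [mul_left_cancel₀ vandermonde_ne_zero e'] at hm
  · intro σ _ hσ
    obtain ⟨i, hi⟩ : ∃ i, i < σ i := by
      by_contra! h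
      exact hσ (eq_one_of_forall_le σ h)
    rw [Finset.prod_eq_zero (i := (i, σ i)) (by simpa using hi) (sub_self _), mul_zero]
  · simp

theorem perm_mem_extIdeal {h : Laurent K r} (hh : h ∈ extIdeal N) (τ : Equiv.Perm (Fin r)) :
    Laurent.perm τ h ∈ extIdeal N := by
  have : extIdeal N ≤ (extIdeal N).comap (Laurent.perm τ) := by
    refine Ideal.span_le.2 ?_
    rintro _ ⟨f, hf, rfl⟩
    change Laurent.perm τ (f : Laurent K r) ∈ extIdeal N
    rw [mem_symLaurent.1 f.2 τ]
    exact Ideal.subset_span ⟨f, hf, rfl⟩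
  exact this hh

theorem sum_perm_mem (h : Laurent K r) : ∑ σ, Laurent.perm σ h ∈ SymLaurent K r := by
  refine mem_symLaurent.2 fun τ => ?_
  rw [map_sum, ← Equiv.sum_comp (Equiv.mulLeft τ) fun σ => Laurent.perm σ h]
  exact Finset.sum_congr rfl fun σ _ => Laurent.perm_perm _ _ _

/-- The multiplier `p` is universally quantified so that the induction passes through multiplication
by non-symmetric elements. -/
theorem exists_alt_eq_sum_perm {h : Laurent K r} (hh : h ∈ extIdeal N) :
    ∀ p, ∃ P, vandermonde K r * ∑ σ, Laurent.perm σ (p * h) = alt (N * P) := by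
  induction hh using Submodule.span_induction with
  | mem a ha =>
    obtain ⟨f, ⟨P, hP⟩, rfl⟩ := ha
    refine fun p => ⟨(∑ σ, Laurent.perm σ p) * P, ?_⟩
    rw [mul_left_comm N, ← mul_alt (sum_perm_mem p), ← hP, mul_left_comm, Finset.sum_mul]
    congr 1
    exact Finset.sum_congr rfl fun σ _ => by rw [map_mul, mem_symLaurent.1 f.2 σ]
  | zero => exact fun p => ⟨0, by simp [alt]⟩
  | add a b _ _ ha hb =>
    intro p
    obtain ⟨P, hP⟩ := ha p
    obtain ⟨Q, hQ⟩ := hb p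
    refine ⟨P + Q, ?_⟩
    simp only [alt, mul_add, map_add, Finset.sum_add_distrib] at hP hQ ⊢
    rw [hP, hQ]
  | smul q a _ ha =>
    intro p
    obtain ⟨P, hP⟩ := ha (p * q)
    exact ⟨P, by rw [← hP, smul_eq_mul, mul_assoc]⟩

/-- A symmetric element is its own average, so the multiplier 1/r! is used. -/
theorem mem_symIdeal_of_mem_extIdeal [CharZero K] {f : SymLaurent K r}
    (hf : (f : Laurent K r) ∈ extIdeal N) : f ∈ symIdeal N := by
  obtain ⟨P, hP⟩ := exists_alt_eq_sum_perm hf (algebraMap K _ ((r.factorial : K)⁻¹))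
  refine ⟨P, ?_⟩
  rw [← hP]
  congr 1
  have h : ∀ σ ∈ (Finset.univ : Finset (Equiv.Perm (Fin r))), Laurent.perm σ
      (algebraMap K _ ((r.factorial : K)⁻¹) * (f : Laurent K r)) =
      algebraMap K _ ((r.factorial : K)⁻¹) * (f : Laurent K r) := fun σ _ => by
    rw [map_mul, AlgHom.commutes, mem_symLaurent.1 f.2 σ]
  rw [Finset.sum_congr rfl h, Finset.sum_const, Finset.card_univ, Fintype.card_perm,
    Fintype.card_fin, nsmul_eq_mul, ← mul_assoc, ← map_natCast (algebraMap K (Laurent K r)),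
    ← map_mul, mul_inv_cancel₀ (Nat.cast_ne_zero.2 r.factorial_ne_zero), map_one, one_mul]
end WheelShuffle

/-! ### Common divisors of the numerators, the upper bound, non-freeness -/

namespace WheelShuffle
variable {K : Type} [Field K] {r : ℕ}

/-- Two elements u, v of an ideal satisfy the relation u · v = v · u, so a basis has only one
member. -/
theorem exists_span_singleton_of_free {S : Type*} [CommRing S] [IsDomain S] (I : Ideal S)
    (hI : I ≠ ⊥) [Module.Free S I] : ∃ a, I = Ideal.span {a} := by
  classical
  let b := Module.Free.chooseBasis S I
  have : Nontrivial I := Submodule.nontrivial_iff_ne_bot.2 hI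
  have hsub : Subsingleton (Module.Free.ChooseBasisIndex S I) := by
    refine ⟨fun i j => ?_⟩
    by_contra hij
    have h : (b j : S) • b i = (b i : S) • b j := Subtype.ext (mul_comm _ _)
    have h' := congrArg (fun v => b.repr v i) h
    simp only [map_smul, Module.Basis.repr_self, Finsupp.smul_apply, Finsupp.single_eq_same,
      Finsupp.single_apply, if_neg (Ne.symm hij), smul_eq_mul, mul_one, mul_zero] at h'
    exact b.ne_zero j (Subtype.ext h')
  obtain ⟨i⟩ := b.index_nonempty
  refine ⟨b i, le_antisymm (fun x hx => ?_) ?_⟩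
  · have h : (⟨x, hx⟩ : I) ∈ Submodule.span S (Set.range b) := b.mem_span _
    rw [Set.range_eq_singleton fun j => congrArg b (Subsingleton.elim j i),
      Submodule.mem_span_singleton] at h
    obtain ⟨s, hs⟩ := h
    exact Ideal.mem_span_singleton'.2 ⟨s, congrArg Subtype.val hs⟩
  · rw [Ideal.span_singleton_le_iff_mem]; exact (b i).2

theorem exists_dvd_of_dvd_mem_closure {S : Type*} [CommRing S] [IsDomain S] {P : Set S}
    (hP : ∀ p ∈ P, Prime p) {f : S} (hf : f ∈ Submonoid.closure P) :
    ∀ a, a ∣ f → IsUnit a ∨ ∃ p ∈ P, p ∣ a := by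
  induction hf using Submonoid.closure_induction_left with
  | one => exact fun a ha => Or.inl (isUnit_of_dvd_one ha)
  | mul_left p hp f _ ih =>
    rintro a ⟨b, hb⟩
    rcases (hP p hp).dvd_or_dvd (hb ▸ dvd_mul_right p f : p ∣ a * b) with h | ⟨c, rfl⟩
    · exact Or.inr ⟨p, hp, h⟩
    · refine ih a ⟨c, mul_left_cancel₀ (hP p hp).ne_zero ?_⟩
      rw [hb]; ring

/-- The substitution `x_b ↦ γ x_a`. -/
def Laurent.glue (a b : Fin r) (γ : Kˣ) : Laurent K r →ₐ[K] Laurent K r :=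
  Laurent.subst (Function.update 1 b γ) (Function.update id b a)

/-- It generates the kernel of the substitution x_b ↦ γ x_a, whose target is a domain. -/
theorem prime_x_sub {a b : Fin r} (hab : a ≠ b) (γ : Kˣ) :
    Prime ((Laurent.x K r b : Laurent K r) - (γ : K) • (Laurent.x K r a : Laurent K r)) := by
  set p := (Laurent.x K r b : Laurent K r) - (γ : K) • (Laurent.x K r a : Laurent K r) with hp
  have h0 : Laurent.glue a b γ p = 0 := by simp [Laurent.glue, hp, hab]
  have hdvd : ∀ f, p ∣ f ↔ Laurent.glue a b γ f = 0 := by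
    refine fun f => ⟨fun ⟨g, hg⟩ => by rw [hg, map_mul, h0, zero_mul], fun h => ?_⟩
    have := Laurent.sub_apply_mem (Laurent.glue a b γ) (Ideal.span {p}) (fun i => ?_) f
    · rwa [h, sub_zero, Ideal.mem_span_singleton] at this
    · by_cases hi : i = b
      · subst hi
        simp [Laurent.glue, ← hp]
      · simp [Laurent.glue, hi]
  refine ⟨fun h => ?_, fun h => ?_, fun f g h => ?_⟩
  · have : (1 : K) • (Laurent.x K r b : Laurent K r) - (γ : K) • (Laurent.x K r a : Laurent K r)
      ≠ 0 := Laurent.smul_x_sub_ne_zero one_ne_zero fun e => absurd e hab.symm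
    exact this (by rwa [one_smul])
  · have := h.map (Laurent.glue a b γ)
    rw [h0] at this
    exact not_isUnit_zero this
  · simpa only [hdvd, map_mul, mul_eq_zero] using h

namespace WeilData
theorem ht_inv {W : Type} (D : WeilData K W) (γ : Kˣ) : D.ht γ⁻¹ = - D.ht γ := by
  have := D.ht_mul γ γ⁻¹
  rw [mul_inv_cancel, D.ht_one] at this
  omega

variable {W : Type} [Fintype W] (D : WeilData K W)

theorem perm_numer (σ : Equiv.Perm (Fin r)) :
    Laurent.perm σ (D.numer r 1) = D.numer r σ := by
  simp [numer, factor, map_prod, map_smul]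

/-- The irreducible factors of the numerators of the pairs `a < b`. -/
def primeFactors (r : ℕ) : Set (Laurent K r) :=
  {p | Prime p ∧ ∃ a b γ, a < b ∧ (D.ht γ = 2 ∨ D.ht γ = -1) ∧ Laurent.glue a b γ p = 0}

theorem factor_mem_closure {a b : Fin r} (hab : a < b) :
    D.factor a b ∈ Submonoid.closure (D.primeFactors r) := by
  refine mul_mem (Submonoid.subset_closure ⟨prime_x_sub hab.ne _, a, b, D.q, hab,
    Or.inl D.ht_q, by simp [Laurent.glue, hab.ne]⟩) (prod_mem fun w _ =>
    Submonoid.subset_closure ⟨prime_x_sub hab.ne' _, a, b, (D.α w)⁻¹, hab, Or.inr ?_, ?_⟩)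
  · rw [D.ht_inv, D.ht_α]
  · simp [Laurent.glue, hab.ne, smul_smul]

/-- For i < j the factor of (j, i) vanishes where x_j / x_i is a Weil number or 1/q, of height 1 or
-2. These never meet the heights 2 and -1 of the ratios that occur for the pairs in increasing
order. -/
theorem glue_factor_ne_zero {a b : Fin r} (hab : a < b) {γ : Kˣ}
    (hγ : D.ht γ = 2 ∨ D.ht γ = -1) {i j : Fin r} (hij : i < j) :
    Laurent.glue a b γ (D.factor j i) ≠ 0 := by
  have key : ∀ (δ : Kˣ), (D.ht δ = 1 ∨ D.ht δ = -2) →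
      Laurent.glue a b γ ((Laurent.x K r j : Laurent K r) -
        (δ : K) • (Laurent.x K r i : Laurent K r)) ≠ 0 := by
    intro δ hδ
    rw [Laurent.glue, map_sub, map_smul, Laurent.subst_x, Laurent.subst_x, smul_smul,
      ← Units.val_mul]
    refine Laurent.smul_x_sub_ne_zero (Units.ne_zero _) fun h e => ?_
    rw [Units.val_inj] at e
    by_cases hj : j = b
    · subst hj
      have hi : i ≠ j := hij.ne
      simp only [Function.update_self, Function.update_of_ne hi, id] at h e
      subst h
      rw [e, Pi.one_apply, mul_one] at hγ
      omega
    · by_cases hi : i = b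
      · subst hi
        simp only [Function.update_self, Function.update_of_ne hj, id] at h
        subst h
        exact lt_asymm hab hij
      · simp only [Function.update_of_ne hi, Function.update_of_ne hj, id] at h
        exact hij.ne' h
  rw [factor, map_mul, map_prod]
  refine mul_ne_zero (fun h => key D.q⁻¹ (Or.inr (by rw [D.ht_inv, D.ht_q])) ?_)
    (Finset.prod_ne_zero_iff.2 fun w _ => key _ (Or.inl (D.ht_α w)))
  have : (Laurent.x K r j : Laurent K r) - ((D.q⁻¹ : Kˣ) : K) • (Laurent.x K r i : Laurent K r) =
      (-((D.q⁻¹ : Kˣ) : K)) • ((Laurent.x K r i : Laurent K r) -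
        (D.q : K) • (Laurent.x K r j : Laurent K r)) := by
    rw [smul_sub, smul_smul, neg_mul, Units.inv_mul, neg_smul, neg_smul, one_smul]
    ring
  rw [this, map_smul, h, smul_zero]

theorem isUnit_of_dvd_numer {a : Laurent K r} (h : ∀ σ, a ∣ D.numer r σ) : IsUnit a := by
  have hmem : D.numer r 1 ∈ Submonoid.closure (D.primeFactors r) :=
    prod_mem fun i _ => prod_mem fun j hj => D.factor_mem_closure (Finset.mem_Ioi.1 hj)
  refine (exists_dvd_of_dvd_mem_closure (fun p hp => hp.1) hmem a (h 1)).resolve_right ?_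
  rintro ⟨p, ⟨-, i, j, γ, hij, hγ, hp⟩, hpa⟩
  -- A prime factor of the numerator of the identity cannot divide that of the order-reversing
  -- permutation.
  obtain ⟨f, hf⟩ := hpa.trans (h Fin.revPerm)
  have := congrArg (Laurent.glue i j γ) hf
  rw [map_mul, hp, zero_mul, numer, map_prod, Finset.prod_eq_zero_iff] at this
  obtain ⟨k, -, h1⟩ := this
  rw [map_prod, Finset.prod_eq_zero_iff] at h1
  obtain ⟨l, hl, h2⟩ := h1
  refine D.glue_factor_ne_zero hij hγ ?_ h2
  simpa using hl

variable (u : (Laurent K r)ˣ)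

theorem numer_mem_extIdeal [CharZero K] (σ : Equiv.Perm (Fin r)) :
    D.numer r σ ∈ extIdeal ((u : Laurent K r) * D.numer r 1) := by
  rw [← D.perm_numer σ]
  refine perm_mem_extIdeal ?_ σ
  have := (extIdeal ((u : Laurent K r) * D.numer r 1)).mul_mem_left ((u⁻¹ : (Laurent K r)ˣ) : Laurent K r)
    (mem_extIdeal ((u : Laurent K r) * D.numer r 1))
  rwa [Units.inv_mul_cancel_left] at this

theorem mem_symIdeal_of_mem_numerIdeal [CharZero K] {f : SymLaurent K r}
    (hf : (f : Laurent K r) ∈ D.numerIdeal r) :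
    f ∈ symIdeal ((u : Laurent K r) * D.numer r 1) := by
  refine mem_symIdeal_of_mem_extIdeal ((Ideal.span_le.2 ?_) hf)
  rintro _ ⟨σ, rfl⟩
  exact D.numer_mem_extIdeal u σ

/-- Weighted symmetrizations vanish on the wheels. -/
theorem eval_eq_zero_of_mem_symIdeal {f : SymLaurent K r}
    (hf : f ∈ symIdeal ((u : Laurent K r) * D.numer r 1)) {z : Fin r → Kˣ} {w : W}
    {i j k : Fin r} (hij : i ≠ j) (hjk : j ≠ k) (hik : i ≠ k) (h1 : z i = D.α w * z j)
    (h2 : z j = D.α (D.bar w) * z k) : Laurent.eval z (f : Laurent K r) = 0 := by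
  obtain ⟨P, hP⟩ := hf
  let c : Fin r → Kˣ := fun a => if a = i then D.q else if a = j then D.α (D.bar w) else 1
  have ci : c i = D.q := by simp [c]
  have cj : c j = D.α (D.bar w) := by simp [c, hij.symm]
  have ck : c k = 1 := by simp [c, hik.symm, hjk.symm]
  have τi : collapse i j k i = k := by simp [collapse]
  have τj : collapse i j k j = k := by simp [collapse]
  have τk : collapse i j k k = k := by simp [collapse]
  have τo : ∀ a, a ≠ i → a ≠ j → collapse i j k a = a := fun a h h' => by simp [collapse, h, h']
  set φ := Laurent.substY c (collapse i j k) with hφ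
  have hx : ∀ a, φ (Laurent.x K r a : Laurent K r) =
      (c a : K) • Laurent.y c (collapse i j k a) := fun a => by
    rw [hφ, Laurent.x_eq_smul_y c, map_smul, Laurent.substY_y]
  have hev : (Laurent.eval z : Laurent K r →ₐ[K] K).comp φ = Laurent.eval z := by
    refine Laurent.algHom_ext fun a => ?_
    rw [AlgHom.comp_apply, hφ, Laurent.substY, Laurent.subst_x, map_smul, Laurent.eval_x,
      Laurent.eval_x, smul_eq_mul, ← Units.val_mul, Units.val_inj]
    by_cases hi : a = i
    · subst hi; rw [τi, ci, ck, h1, h2, ← mul_assoc, D.α_mul_bar, div_one]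
    · by_cases hj : a = j
      · subst hj; rw [τj, cj, ck, h2, div_one]
      · rw [τo a hi hj, div_self', one_mul]
  have hfac : ∀ σ, φ (D.numer r σ) = 0 := by
    intro σ
    have hz : ∀ a b, σ.symm a < σ.symm b → φ (D.factor a b) = 0 → φ (D.numer r σ) = 0 := by
      intro a b hab h
      rw [numer, map_prod]
      refine Finset.prod_eq_zero (Finset.mem_univ (σ.symm a)) ?_
      rw [map_prod]
      refine Finset.prod_eq_zero (Finset.mem_Ioi.2 hab) ?_
      rwa [Equiv.apply_symm_apply, Equiv.apply_symm_apply]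
    have f1 : φ (D.factor i j) = 0 := by
      rw [factor, map_mul, map_prod]
      refine mul_eq_zero_of_right _ (Finset.prod_eq_zero (Finset.mem_univ w) ?_)
      rw [map_sub, map_smul, hx, hx, τi, τj, ci, cj, smul_smul, ← Units.val_mul, D.α_mul_bar,
        sub_self]
    have f2 : φ (D.factor j k) = 0 := by
      rw [factor, map_mul, map_prod]
      refine mul_eq_zero_of_right _ (Finset.prod_eq_zero (Finset.mem_univ (D.bar w)) ?_)
      rw [map_sub, map_smul, hx, hx, τj, τk, cj, ck, Units.val_one, one_smul, sub_self]
    have f3 : φ (D.factor k i) = 0 := by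
      rw [factor, map_mul]
      refine mul_eq_zero_of_left ?_ _
      rw [map_sub, map_smul, hx, hx, τi, τk, ci, ck, Units.val_one, one_smul, sub_self]
    -- A total order cannot go against all three arcs of the cycle i → j → k → i.
    by_cases o1 : σ.symm i < σ.symm j
    · exact hz _ _ o1 f1
    by_cases o2 : σ.symm j < σ.symm k
    · exact hz _ _ o2 f2
    refine hz _ _ (lt_of_le_of_ne ((not_lt.1 o2).trans (not_lt.1 o1)) ?_) f3
    exact fun e => hik (σ.symm.injective e).symm
  have hΔ : φ (vandermonde K r) ≠ 0 := by
    simp only [vandermonde, map_prod]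
    refine Finset.prod_ne_zero_iff.2 fun a _ => Finset.prod_ne_zero_iff.2 fun b hb => ?_
    have hab : a ≠ b := (Finset.mem_Ioi.1 hb).ne
    rw [map_sub, hφ, Laurent.substY, Laurent.subst_x, Laurent.subst_x]
    refine Laurent.smul_x_sub_ne_zero (Units.ne_zero _) fun h e => ?_
    rw [← h, Units.val_inj, div_left_inj] at e
    -- The three collapsed variables stay distinct because their scalars have heights 2, 1 and 0.
    have hc : ∀ a, D.ht (c a) = if a = i then 2 else if a = j then 1 else 0 := fun a => by
      simp only [c]; split_ifs <;> simp only [D.ht_q, D.ht_α, D.ht_one]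
    have he := congrArg D.ht e
    rw [hc, hc] at he
    unfold collapse at h
    split_ifs at he h <;> simp_all
  have h0 := congrArg φ hP
  rw [map_mul, alt, map_sum, Finset.sum_eq_zero, mul_eq_zero] at h0
  · have := h0.resolve_left hΔ
    rw [← hev, AlgHom.comp_apply, this, map_zero]
  · intro σ _
    rw [map_mul, map_mul, map_mul, map_mul, map_mul, D.perm_numer, hfac]
    simp

theorem not_free_symIdeal [CharZero K] [Nonempty W] (hr : 2 < r) :
    ¬ Module.Free (SymLaurent K r) (symIdeal ((u : Laurent K r) * D.numer r 1)) := by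
  intro hfree
  set A := symIdeal ((u : Laurent K r) * D.numer r 1) with hA
  obtain ⟨a, ha⟩ := exists_span_singleton_of_free A fun h => by
    have h1 : D.numer r 1 ≠ 0 := Finset.prod_ne_zero_iff.2 fun i _ =>
      Finset.prod_ne_zero_iff.2 fun j hj => mul_ne_zero
        (prime_x_sub (Finset.mem_Ioi.1 hj).ne _).ne_zero
        (Finset.prod_ne_zero_iff.2 fun w _ => (prime_x_sub (Finset.mem_Ioi.1 hj).ne' _).ne_zero)
    have := D.numer_mem_extIdeal u 1
    rw [extIdeal, ← hA, h] at this
    exact h1 (by simpa using this)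
  have hdvd : ∀ σ, (a : Laurent K r) ∣ D.numer r σ := by
    intro σ
    have hle : extIdeal ((u : Laurent K r) * D.numer r 1) ≤ Ideal.span {(a : Laurent K r)} := by
      refine Ideal.span_le.2 ?_
      rintro _ ⟨f, hf, rfl⟩
      rw [← hA, SetLike.mem_coe, ha, Ideal.mem_span_singleton] at hf
      obtain ⟨s, rfl⟩ := hf
      exact Ideal.mem_span_singleton.2 ⟨s, rfl⟩
    exact Ideal.mem_span_singleton.1 (hle (D.numer_mem_extIdeal u σ))
  have hunit := D.isUnit_of_dvd_numer hdvd
  obtain ⟨w⟩ := ‹Nonempty W›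
  let i : Fin r := ⟨0, by omega⟩
  let j : Fin r := ⟨1, by omega⟩
  let k : Fin r := ⟨2, by omega⟩
  have hij : i ≠ j := by simp [i, j]
  have hjk : j ≠ k := by simp [j, k]
  have hik : i ≠ k := by simp [i, k]
  let z : Fin r → Kˣ := fun a => if a = i then D.q else if a = j then D.α (D.bar w) else 1
  have hz := D.eval_eq_zero_of_mem_symIdeal u (f := a)
    (by rw [← hA, ha]; exact Ideal.mem_span_singleton_self a) (z := z) (w := w) hij hjk hik
    (by simp [z, hij.symm, D.α_mul_bar]) (by simp [z, hij.symm, hik.symm, hjk.symm])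
  have := hunit.map (Laurent.eval z : Laurent K r →ₐ[K] K)
  rw [hz] at this
  exact not_isUnit_zero this
end WeilData
end WheelShuffle

/-! ### The universal Weil numbers and their height -/

namespace WheelShuffle
open MvPolynomial

/-- The degree for which `α_i` has degree `1` and `q` has degree `2`. -/
def polyHeight {g : ℕ} (p : MvPolynomial (Option (Fin g)) ℂ) : ℤ :=
  p.totalDegree + p.degreeOf none

theorem polyHeight_mul {g : ℕ} {a b : MvPolynomial (Option (Fin g)) ℂ} (ha : a ≠ 0) (hb : b ≠ 0) :
    polyHeight (a * b) = polyHeight a + polyHeight b := by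
  rw [polyHeight, totalDegree_mul_of_isDomain ha hb, degreeOf_mul_eq ha hb, polyHeight, polyHeight]
  push_cast
  ring

/-- The extension of `polyHeight` to fractions. -/
def height (g : ℕ) (x : (Ka g)ˣ) : ℤ :=
  polyHeight (IsLocalization.sec (nonZeroDivisors (MvPolynomial (Option (Fin g)) ℂ)) (x : Ka g)).1 -
  polyHeight ((IsLocalization.sec (nonZeroDivisors (MvPolynomial (Option (Fin g)) ℂ)) (x : Ka g)).2 :
    MvPolynomial (Option (Fin g)) ℂ)

/-- Cross-multiplication and additivity of `polyHeight` show that the chosen fraction does not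
matter. -/
theorem height_eq {g : ℕ} {x : (Ka g)ˣ} {a b : MvPolynomial (Option (Fin g)) ℂ} (hb : b ≠ 0)
    (h : (x : Ka g) * algebraMap _ (Ka g) b = algebraMap _ (Ka g) a) :
    height g x = polyHeight a - polyHeight b := by
  have hinj := FaithfulSMul.algebraMap_injective (MvPolynomial (Option (Fin g)) ℂ) (Ka g)
  rw [height]
  set s := IsLocalization.sec (nonZeroDivisors (MvPolynomial (Option (Fin g)) ℂ)) (x : Ka g)
  have hs : (x : Ka g) * algebraMap _ (Ka g) (s.2 : MvPolynomial (Option (Fin g)) ℂ) =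
      algebraMap _ (Ka g) s.1 := IsLocalization.sec_spec _ _
  have hs2 : (s.2 : MvPolynomial (Option (Fin g)) ℂ) ≠ 0 := nonZeroDivisors.ne_zero s.2.2
  have hne : ∀ {c d : MvPolynomial (Option (Fin g)) ℂ}, d ≠ 0 →
      (x : Ka g) * algebraMap _ (Ka g) d = algebraMap _ (Ka g) c → c ≠ 0 := by
    rintro c d hd h rfl
    rw [map_zero] at h
    exact (mul_ne_zero x.ne_zero ((map_ne_zero_iff _ hinj).2 hd)) h
  have e : s.1 * b = a * s.2 := hinj (by rw [map_mul, map_mul, ← hs, ← h]; ring)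
  have := congrArg polyHeight e
  rw [polyHeight_mul (hne hs2 hs) hb, polyHeight_mul (hne hb h) hs2] at this
  omega

theorem height_mul {g : ℕ} (x y : (Ka g)ˣ) : height g (x * y) = height g x + height g y := by
  have hinj := FaithfulSMul.algebraMap_injective (MvPolynomial (Option (Fin g)) ℂ) (Ka g)
  have key : ∀ x : (Ka g)ˣ, ∃ a b : MvPolynomial (Option (Fin g)) ℂ, a ≠ 0 ∧ b ≠ 0 ∧
      (x : Ka g) * algebraMap _ (Ka g) b = algebraMap _ (Ka g) a := by
    intro x
    obtain ⟨⟨a, b⟩, h⟩ := IsLocalization.surj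
      (nonZeroDivisors (MvPolynomial (Option (Fin g)) ℂ)) (x : Ka g)
    refine ⟨a, b, ?_, nonZeroDivisors.ne_zero b.2, h⟩
    rintro rfl
    rw [map_zero] at h
    exact (mul_ne_zero x.ne_zero ((map_ne_zero_iff _ hinj).2 (nonZeroDivisors.ne_zero b.2))) h
  obtain ⟨a, b, ha, hb, h⟩ := key x
  obtain ⟨a', b', ha', hb', h'⟩ := key y
  rw [height_eq hb h, height_eq hb' h', height_eq (a := a * a') (b := b * b') (mul_ne_zero hb hb')
    (by rw [map_mul, map_mul, ← h, ← h', Units.val_mul]; ring),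
    polyHeight_mul ha ha', polyHeight_mul hb hb']
  ring

theorem q_ne_zero (g : ℕ) : q g ≠ 0 := by simp [q]

theorem alpha_ne_zero (g : ℕ) (i : Fin g) : alpha g i ≠ 0 := by simp [alpha]

theorem weil_ne_zero (g : ℕ) (w : Fin g ⊕ Fin g) : weil g w ≠ 0 := by
  rcases w with i | i
  · exact alpha_ne_zero g i
  · exact div_ne_zero (q_ne_zero g) (alpha_ne_zero g i)

theorem weil_mul_swap (g : ℕ) (w : Fin g ⊕ Fin g) : weil g w * weil g w.swap = q g := by
  rcases w with i | i
  · exact mul_div_cancel₀ _ (alpha_ne_zero g i)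
  · exact div_mul_cancel₀ _ (alpha_ne_zero g i)

theorem alpha_injective (g : ℕ) : Function.Injective (alpha g) := fun i j h => by
  have := X_injective (FaithfulSMul.algebraMap_injective (MvPolynomial (Option (Fin g)) ℂ) (Ka g) h)
  exact Option.some_injective _ this

theorem alpha_mul_alpha_ne (g : ℕ) (i j : Fin g) : alpha g i * alpha g j ≠ q g := by
  intro h
  rw [alpha, alpha, q, ← map_mul] at h
  -- Specialise to q = 1 and all α = 0.
  have := congrArg (eval fun k : Option (Fin g) => if k = none then (1 : ℂ) else 0)
    (FaithfulSMul.algebraMap_injective (MvPolynomial (Option (Fin g)) ℂ) (Ka g) h)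
  simp at this

theorem weil_injective (g : ℕ) : Function.Injective (weil g) := by
  rintro (i | i) (j | j) h
  · rw [alpha_injective g h]
  · exact absurd ((eq_div_iff (alpha_ne_zero g j)).1 h) (alpha_mul_alpha_ne g i j)
  · exact absurd ((eq_div_iff (alpha_ne_zero g i)).1 h.symm) (alpha_mul_alpha_ne g j i)
  · have : q g / alpha g i = q g / alpha g j := h
    rw [div_eq_div_iff (alpha_ne_zero g i) (alpha_ne_zero g j)] at this
    rw [alpha_injective g (mul_left_cancel₀ (q_ne_zero g) this)]

/-- The universal Weil numbers. -/
def weilData (g : ℕ) : WeilData (Ka g) (Fin g ⊕ Fin g) where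
  α w := Units.mk0 (weil g w) (weil_ne_zero g w)
  q := Units.mk0 (q g) (q_ne_zero g)
  bar := Sum.swap
  α_mul_bar w := Units.ext (weil_mul_swap g w)
  α_injective w w' h := weil_injective g (congrArg Units.val h)
  ht := height g
  ht_mul := height_mul
  ht_α := by
    rintro (i | i)
    · rw [height_eq (a := X (some i)) (b := 1) one_ne_zero (by rw [map_one, mul_one]; rfl)]
      simp [polyHeight, degreeOf_X]
    · rw [height_eq (a := X none) (b := X (some i)) (X_ne_zero _)
        (div_mul_cancel₀ _ (alpha_ne_zero g i))]
      simp [polyHeight, degreeOf_X]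
  ht_q := by
    rw [height_eq (a := X none) (b := 1) one_ne_zero (by rw [map_one, mul_one]; rfl)]
    simp [polyHeight]

/-! ### Rational functions and the clearing of denominators -/

section RatFun
variable {K : Type} [Field K] {r : ℕ}

theorem toRat_x (i : Fin r) : toRat K r (Laurent.x K r i : Laurent K r) = RatFun.x K r i :=
  Laurent.eval_x _ _

theorem RatFun.perm_x (σ : Equiv.Perm (Fin r)) (i : Fin r) :
    RatFun.perm K r σ (RatFun.x K r i) = RatFun.x K r (σ i) := by
  simp [RatFun.perm, RatFun.x]

theorem toRat_perm (σ : Equiv.Perm (Fin r)) (f : Laurent K r) :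
    toRat K r (Laurent.perm σ f) = RatFun.perm K r σ (toRat K r f) := by
  have : (toRat K r).comp (Laurent.perm σ) =
      (RatFun.perm K r σ : RatFun K r →ₐ[K] RatFun K r).comp (toRat K r) :=
    Laurent.algHom_ext fun i => by
      simp only [AlgHom.comp_apply, Laurent.eval_x, toRat_x]
      exact (RatFun.perm_x σ i).symm
  exact DFunLike.congr_fun this f

theorem RatFun.x_sub_ne_zero {i j : Fin r} (h : i ≠ j) :
    (RatFun.x K r i : RatFun K r) - RatFun.x K r j ≠ 0 := by
  rw [sub_ne_zero]
  intro e
  exact h (X_injective (FaithfulSMul.algebraMap_injective (MvPolynomial (Fin r) K) (RatFun K r) e))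

theorem toRat_vandermonde_ne_zero : toRat K r (vandermonde K r) ≠ 0 := by
  simp only [vandermonde, map_prod, map_sub, toRat_x]
  exact Finset.prod_ne_zero_iff.2 fun i _ => Finset.prod_ne_zero_iff.2 fun j hj =>
    RatFun.x_sub_ne_zero (Finset.mem_Ioi.1 hj).ne
end RatFun

/-- The unit by which the numerator of the weight differs from the product of its factors. -/
def weightUnit (g r : ℕ) : (Laurent (Ka g) r)ˣ :=
  ∏ i : Fin r, ∏ j ∈ Finset.Ioi i,
    (Laurent.x (Ka g) r i / Laurent.x (Ka g) r j) ^ ((g : ℤ) - 1) *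
      (Laurent.x (Ka g) r j)⁻¹ * Laurent.x (Ka g) r i *
      ∏ _w : Fin g ⊕ Fin g, (Laurent.x (Ka g) r i)⁻¹

/-- The Laurent polynomial `weight * Δ`. -/
def weightNumer (g r : ℕ) : Laurent (Ka g) r :=
  (weightUnit g r : Laurent (Ka g) r) * (weilData g).numer r 1

/-- The only pole outside the torus boundary is 1 - z⁻¹ = (x - y)/x at z = x/y, which x - y cancels.
-/
theorem gX_mul_sub {g : ℕ} {F : Type} [Field F] [Algebra (Ka g) F] {x y : F} (hx : x ≠ 0)
    (hy : y ≠ 0) (hxy : x - y ≠ 0) :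
    gX g (x / y) * (x - y) = ((x / y) ^ ((g : ℤ) - 1) * y⁻¹ * x * ∏ _w : Fin g ⊕ Fin g, x⁻¹) *
      ((y - q g • x) * ∏ w : Fin g ⊕ Fin g, (x - weil g w • y)) := by
  have h1 : ∏ w : Fin g ⊕ Fin g, (1 - algebraMap (Ka g) F (weil g w) * (x / y)⁻¹) =
      (∏ _w : Fin g ⊕ Fin g, x⁻¹) * ∏ w : Fin g ⊕ Fin g, (x - weil g w • y) := by
    rw [← Finset.prod_mul_distrib]
    refine Finset.prod_congr rfl fun w _ => ?_
    rw [Algebra.smul_def]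
    field_simp
  have h2 : (1 - algebraMap (Ka g) F (q g) * (x / y)) / (1 - (x / y)⁻¹) * (x - y) =
      y⁻¹ * x * (y - q g • x) := by
    rw [Algebra.smul_def, inv_div, one_sub_div hx]
    field_simp
  rw [gX, h1]
  linear_combination (x / y) ^ ((g : ℤ) - 1) * ((∏ _w : Fin g ⊕ Fin g, x⁻¹) *
    ∏ w : Fin g ⊕ Fin g, (x - weil g w • y)) * h2

theorem weight_mul_vandermonde (g r : ℕ) :
    weight g r * toRat (Ka g) r (vandermonde (Ka g) r) = toRat (Ka g) r (weightNumer g r) := by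
  have hu : ∀ v : (Laurent (Ka g) r)ˣ, toRat (Ka g) r (v : Laurent (Ka g) r) =
      (Units.map (toRat (Ka g) r : Laurent (Ka g) r →* RatFun (Ka g) r) v : RatFun (Ka g) r) :=
    fun v => rfl
  have hx : ∀ i, Units.map (toRat (Ka g) r : Laurent (Ka g) r →* RatFun (Ka g) r)
      (Laurent.x (Ka g) r i) = RatFun.x (Ka g) r i := fun i => Units.ext (toRat_x i)
  rw [weightNumer, map_mul, hu, weightUnit, WeilData.numer, weight, vandermonde]
  simp only [map_prod, map_sub, toRat_x, map_mul, map_zpow, map_div, map_inv, hx, Units.coe_prod]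
  rw [← Finset.prod_mul_distrib, ← Finset.prod_mul_distrib]
  refine Finset.prod_congr rfl fun i _ => ?_
  rw [← Finset.prod_mul_distrib, ← Finset.prod_mul_distrib]
  refine Finset.prod_congr rfl fun j hj => ?_
  rw [gX_mul_sub (Units.ne_zero _) (Units.ne_zero _)
    (RatFun.x_sub_ne_zero (Finset.mem_Ioi.1 hj).ne)]
  simp [WeilData.factor, map_prod, toRat_x, weilData]

/-- In the summand of σ write Δ = sgn(σ) σ(Δ); then σ(Δ) clears the denominator and the signs make
the sum alternating. -/
theorem Psi_mul_vandermonde (g r : ℕ) (P : Laurent (Ka g) r) :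
    toRat (Ka g) r (vandermonde (Ka g) r) * Psi g r P =
      toRat (Ka g) r (alt (weightNumer g r * P)) := by
  simp only [Psi, LinearMap.sum_apply, alt, map_sum, Finset.mul_sum]
  refine Finset.sum_congr rfl fun σ _ => ?_
  have h : toRat (Ka g) r (vandermonde (Ka g) r) = ((σ.sign : ℤ) : RatFun (Ka g) r) *
      RatFun.perm (Ka g) r σ (toRat (Ka g) r (vandermonde (Ka g) r)) := by
    rw [← toRat_perm, perm_vandermonde, map_mul, map_intCast, ← mul_assoc, ← Int.cast_mul,
      ← Units.val_mul, Int.units_mul_self, Units.val_one, Int.cast_one, one_mul]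
  change _ * RatFun.perm (Ka g) r σ (weight g r * toRat (Ka g) r P) = _
  rw [map_mul (toRat (Ka g) r), map_intCast, toRat_perm, map_mul (toRat (Ka g) r),
    ← weight_mul_vandermonde, map_mul, map_mul, map_mul]
  nth_rw 1 [h]
  ring

theorem mem_wheelIdeal {g r : ℕ} {f : SymLaurent (Ka g) r} :
    f ∈ wheelIdeal g r ↔ ∀ z ∈ wheelLocus g r, Laurent.eval z (f : Laurent (Ka g) r) = 0 := by
  simp only [wheelIdeal, Ideal.mem_iInf]
  rfl

theorem shuffleA_eq (g r : ℕ) : (shuffleA g r : Set (RatFun (Ka g) r)) =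
    (fun f : SymLaurent (Ka g) r => toRat (Ka g) r f) '' symIdeal (weightNumer g r) := by
  have key : ∀ (f : SymLaurent (Ka g) r) P,
      vandermonde (Ka g) r * (f : Laurent (Ka g) r) = alt (weightNumer g r * P) →
      toRat (Ka g) r f = Psi g r P := fun f P h => by
    refine mul_left_cancel₀ toRat_vandermonde_ne_zero ?_
    rw [Psi_mul_vandermonde, ← h, map_mul]
  ext F
  constructor
  · rintro ⟨P, rfl⟩
    obtain ⟨f, hf, h⟩ := exists_mem_symIdeal (weightNumer g r) P
    exact ⟨f, hf, key f P h⟩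
  · rintro ⟨f, ⟨P, h⟩, rfl⟩
    exact ⟨P, (key f P h).symm⟩

/-- The even exponent removes the sign by which a permutation acts on Δ. -/
theorem vandermonde_sq_pow_mem (K : Type) [Field K] (r n : ℕ) :
    vandermonde K r ^ (2 * n) ∈ SymLaurent K r := by
  refine mem_symLaurent.2 fun σ => ?_
  rw [pow_mul, map_pow, map_pow, perm_vandermonde, mul_pow, ← Int.cast_pow, ← Units.val_pow_eq_pow_val,
    Int.units_sq, Units.val_one, Int.cast_one, one_mul]
end WheelShuffle

end

theorem mainTheorem5 (g r : ℕ) (hr : 1 ≤ r) :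
    ∃ A : Ideal (WheelShuffle.SymLaurent (WheelShuffle.Ka g) r),
      -- `A` is `A_{K_a, r}`, which therefore is an ideal of symmetric Laurent polynomials
      (WheelShuffle.shuffleA g r : Set (WheelShuffle.RatFun (WheelShuffle.Ka g) r)) =
        (fun f : WheelShuffle.SymLaurent (WheelShuffle.Ka g) r =>
          WheelShuffle.toRat (WheelShuffle.Ka g) r f) '' A ∧
      -- the lower bound; the exponent is `r! / 2` for `r ≥ 4`, and `0, 0, 2` for `r = 1, 2, 3`
      (∀ f ∈ WheelShuffle.wheelIdeal g r, ∃ a ∈ A,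
        (a : WheelShuffle.Laurent (WheelShuffle.Ka g) r) =
          WheelShuffle.vandermonde (WheelShuffle.Ka g) r ^ (2 * (r.factorial / 4)) * f) ∧
      -- the upper bound
      A ≤ WheelShuffle.wheelIdeal g r ∧
      (2 < r → 0 < g →
        ¬ Module.Free (WheelShuffle.SymLaurent (WheelShuffle.Ka g) r) A) := by
  open WheelShuffle in
  refine ⟨symIdeal (weightNumer g r), shuffleA_eq g r, fun f hf => ?_, fun f hf => ?_,
    fun h2 hg => ?_⟩
  · rw [mem_wheelIdeal] at hf
    refine ⟨⟨_, mul_mem (vandermonde_sq_pow_mem _ r _) f.2⟩,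
      (weilData g).mem_symIdeal_of_mem_numerIdeal _ ?_, rfl⟩
    refine (weilData g).vandermonde_pow_mul_mem_numerIdeal fun z w i j k hij hjk hik h1 h2 => ?_
    exact hf z ⟨w, i, j, k, hij, hjk, hik, congrArg Units.val h1, congrArg Units.val h2⟩
  · rw [mem_wheelIdeal]
    rintro z ⟨w, i, j, k, hij, hjk, hik, h1, h2⟩
    exact (weilData g).eval_eq_zero_of_mem_symIdeal (weightUnit g r) hf (w := w) hij hjk hik
      (Units.ext h1) (Units.ext h2)
  · have : Nonempty (Fin g ⊕ Fin g) := ⟨Sum.inl ⟨0, hg⟩⟩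
    exact (weilData g).not_free_symIdeal _ h2
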